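/- **Setting.** A finite node set $\mathcal V$ is partitioned into depots $\mathcal V_D$, tasks $\mathcal V_T$ and charging stations $\mathcal V_R$; each arc $(i,j)\in\mathcal A$ has a time $t(i,j)>0$, a cost $c(i,j)>0$ and a battery use $b(i,j)>0$; station $i\in\mathcal V_R$ has a unit charging cost $\delta(i)>0$; $T,B>0$ are the horizon and the battery capacity. A *partial path* is a node sequence $n_0,\dots,n_m$ along arcs with $n_0\in\mathcal V_D$ and $n_1,\dots,n_{m-1}\in\mathcal V_T\cup\mathcal V_R$, together with charging times $\tau_k\ge 0$ at the stations $n_k$, $1\le k\le m-1$. With $t_0=0$, $b_0=B$, and (reading $\tau_k=0$ if $n_k\notin\mathcal V_R$) $t_{k+1}=t_k+\tau_k+t(n_k,n_{k+1})$, $b_{k+1}=\min\{b_k+\tau_k,B\}-b(n_k,n_{k+1})$, it is feasible if $t_k\in[0,T]$, $b_k\in[0,B]$ for $k=1,\dots,m$. It is a *path* if $m\ge1$ and $n_m\in\mathcal V_D$. Its cost $c^p$ is the total arc cost plus $\sum_k\delta(n_k)\tau_k$ over the stations. A *partial subpath* is a node sequence along arcs that starts in $\mathcal V_D\cup\mathcal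 V_R$ and has only tasks strictly in between; it is feasible if its total time is at most $T$ and its total battery use at most $B$; it is a *subpath* if it has at least one arc and ends in $\mathcal V_D\cup\mathcal V_R$. A path set $\mathcal P$ is given by a condition on node sequences that is inherited by contiguous subsequences (for example: no condition, elementarity, or ng-feasibility); $\mathcal P$, $\mathcal P^\circ$, $\mathcal S$, $\mathcal S^\circ$ are the sets of all feasible paths, partial paths, subpaths and partial subpaths that satisfy the condition. A *subpath sequence* $\sigma=(s_1,\dots,s_m)$ consists of $m\ge 1$ subpaths in $\mathcal S$, starts in a depot, and consecutive subpaths meet in a charging station; it is feasible if some partial path in $\mathcal P^\circ$ has this decomposition, and complete if it ends in a depot; $\Sigma^\circ$ is the set of feasible ones, and $\sigma\oplus s$ appends a subpath. The relaxation $\overline{\mathrm{ERSP}}(\mathcal Q)$ over a set $\mathcal Q$ of paths minimizes $\sum_p c^pz^p$ over finitely supported $z\ge0$ on $\mathcal Q$, subject to: the total weight of the paths starting in depot $j$ equals $v^{\mathrm{start}}_j$ and that of the paths ending in $j$ is at least $v^{\mathrm{end}}_j$ (for all $j\in\mathcal V_D$), and $\sum_p\gamma_i^pz^p=1$ for all $i\in\mathcal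 V_T$, where $\gamma^p_i$ counts the visits of $p$ to $i$. With dual variables $\kappa,\mu\ge0,\nu$ the reduced cost is $\bar c^p=c^p-\kappa_{\mathrm{start}(p)}-\mu_{\mathrm{end}(p)}-\sum_i\gamma^p_i\nu_i$. The reduced cost contribution of a partial subpath $s$ is $\bar c^s=\sum_{\ell}\bigl(c(n_\ell,n_{\ell+1})-\mathbf 1[n_{\ell+1}\in\mathcal V_T]\nu_{n_{\ell+1}}\bigr)-\mathbf 1[n_0\in\mathcal V_D]\kappa_{n_0}-\mathbf 1[n_m\in\mathcal V_D]\mu_{n_m}$; that of a partial path is the sum over its subpaths plus its charging cost. A *minimal path* $p(\sigma)$ of $\sigma\in\Sigma^\circ$ minimizes the contribution over the partial paths in $\mathcal P^\circ$ with subpath sequence $\sigma$. **Domination criteria.** For all dual variables, let $\mathrm{ND}_s$, $\mathrm{ND}_\sigma$ be labels and $\mathrm D_s$, $\mathrm D_\sigma$ real vectors attached to partial subpaths and to subpath sequences, where $\mathrm{ND}$ determines the starting and the ending node. Say that $x$ dominates $y$, $x\succeq y$, if $\mathrm{ND}_x=\mathrm{ND}_y$ and $\mathrm D_x\le\mathrm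 D_y$ componentwise. Assume, for all dual variables: 1. if $s_1\succeq s_2$ in $\mathcal S^\circ$ and the arc $a$ extends both, then $s_2\oplus a\notin\mathcal S^\circ$, or $s_1\oplus a,s_2\oplus a\in\mathcal S^\circ$ and $s_1\oplus a\succeq s_2\oplus a$; 2. (i) if $\sigma_1\succeq\sigma_2$ in $\Sigma^\circ$ and $s\in\mathcal S$ extends both, then $\sigma_2\oplus s\notin\Sigma^\circ$, or $\sigma_1\oplus s,\sigma_2\oplus s\in\Sigma^\circ$ and $\sigma_1\oplus s\succeq\sigma_2\oplus s$; (ii) if $s_1\succeq s_2$ in $\mathcal S$ both extend $\sigma$, where $\sigma\in\Sigma^\circ$ or $\sigma$ is empty, then $\sigma\oplus s_2\notin\Sigma^\circ$, or $\sigma\oplus s_1,\sigma\oplus s_2\in\Sigma^\circ$ and $\sigma\oplus s_1\succeq\sigma\oplus s_2$; 3. on $\mathcal S^\circ$, one component of $\mathrm D_s$ is $\bar c^s$, and one is nonnegative, bounded by a constant, and strictly increasing under extension; 4. on $\Sigma^\circ$, one component of $\mathrm D_\sigma$ is the contribution $\bar c^{p(\sigma)}$, $\sigma_1\succeq\sigma_2$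 implies $\bar c^{p(\sigma_1)}\le\bar c^{p(\sigma_2)}$, and one component is nonnegative, bounded by a constant, and strictly increasing under extension. **Algorithm.** *Label setting* keeps a queue and a set of generated labels. While the queue is nonempty, a label with smallest time stamp moves from the queue to the generated labels; unless it is final, each of its extensions is treated in turn: it is discarded if it is infeasible or dominated by a label in the queue or among the generated ones; otherwise the labels in the queue that it dominates are removed, and it joins the queue. *First level:* the labels are partial subpaths, initially all single nodes in $\mathcal V_D\cup\mathcal V_R$ (which are never used to discard other labels); they are extended along arcs; subpaths are final; $\mathcal S^*$ is the set of generated subpaths. *Second level:* the labels are subpath sequences, initially the one-element sequences from $\mathcal S^*$ starting in a depot; they are extended by subpaths in $\mathcal S^*$; complete sequences are final; the output is one minimal path for each generated complete sequence. *Column generation* starts from a finite set $\mathcal P_0\subseteq\mathcal P$ whose master problem is feasible; in iteration $\ell$ it takes any optimal solution $z_\ell$ of $\overline{\mathrm{ERSP}}(\mathcal P_\ell)$ and any optimal solution of its dual, runs the two levels for these dual variables, and lets $\mathcal P_{\mathrm{new}}$ be the paths of negative reduced cost in the output; it stops and returns $z_\ell$ if $\mathcal P_{\mathrm{new}}=\emptyset$,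 and otherwise continues with $\mathcal P_{\ell+1}=\mathcal P_\ell\cup\mathcal P_{\mathrm{new}}$. **Theorem.** For every such path set $\mathcal P$ and all such criteria, column generation with two-level label-setting pricing always terminates after finitely many steps (every master problem and its dual have optimal solutions, both levels of every pricing call terminate, and finitely many iterations are made), whatever choices are made in its execution, and the solution that it returns is an optimal solution of the semi-infinite linear program $\overline{\mathrm{ERSP}}(\mathcal P)$. -/

import Mathlib

noncomputable section

namespace ERSP

/-- Nodes are partitioned into depots, tasks and charging stations. -/
inductive NodeKind where
  | depot
  | task
  | charger
  deriving DecidableEq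

/-- The data of an electric routing-scheduling problem on the node set `V`. The planning horizon is
`T`, the battery capacity is `B`, and charging for a time `τ` at the station `i` adds `τ` units
of charge at the cost `chargeRate i * τ`. No triangle inequality is imposed. -/
structure Instance (V : Type*) where
  kind : V → NodeKind
  arc : V → V → Prop
  time : V → V → ℝ
  cost : V → V → ℝ
  energy : V → V → ℝ
  chargeRate : V → ℝ
  B : ℝ
  T : ℝ
  vStart : V → ℕ
  vEnd : V → ℕ
  time_pos : ∀ i j, arc i j → 0 < time i j
  cost_pos : ∀ i j, arc i j → 0 < cost i j
  energy_pos : ∀ i j, arc i j → 0 < energy i j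
  chargeRate_pos : ∀ i, kind i = NodeKind.charger → 0 < chargeRate i
  B_pos : 0 < B
  T_pos : 0 < T

/-- A condition on node sequences that is inherited by contiguous subsequences. It specifies which
node sequences a path set admits: all of them, the elementary ones, the ng-feasible ones, … -/
structure SequenceRule (V : Type*) where
  Admits : List V → Prop
  of_infix : ∀ l l' : List V, l <:+: l' → Admits l' → Admits l

/-- Dual variables. Only the values of `κ` and `μ` at depots and of `ν` at tasks are ever used. -/
structure Duals (V : Type*) where
  κ : V → ℝ
  μ : V → ℝ
  ν : V → ℝ

/-- A (partial) path: its nodes `n_0, …, n_m` in order, each with the charging time `τ_k` spent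
there. By convention `τ_k = 0` where no charging decision is taken. -/
abbrev Path (V : Type*) := List (V × ℝ)

/-- The node sequence `U(p)` of a (partial) path. -/
def nodes {V : Type*} (p : Path V) : List V := p.map Prod.fst

/-- `arcSum f [n_0, …, n_m] = f n_0 n_1 + ⋯ + f n_{m-1} n_m`. -/
def arcSum {V : Type*} (f : V → V → ℝ) : List V → ℝ
  | u :: v :: l => f u v + arcSum f (v :: l)
  | _ => 0

/-- The node sequence of a sequence of subpaths; the node at which two consecutive subpaths meet is
not repeated. -/
def joinNodes {V : Type*} : List (List V) → List V
  | [] => []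
  | s :: σ => s ++ (σ.map List.tail).flatten

namespace Instance

variable {V : Type*} [Fintype V] [DecidableEq V] (I : Instance V) (R : SequenceRule V)

/-! ### Paths -/

/-- Arrival time at `w` when the node of the stop `x` is reached at time `t`. -/
def nextTime (t : ℝ) (x : V × ℝ) (w : V) : ℝ :=
  t + (if I.kind x.1 = NodeKind.charger then x.2 else 0) + I.time x.1 w

/-- Arrival charge at `w` when the node of the stop `x` is reached with charge `b`. -/
def nextCharge (b : ℝ) (x : V × ℝ) (w : V) : ℝ :=
  (if I.kind x.1 = NodeKind.charger then min (b + x.2) I.B else b) - I.energy x.1 w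

/-- When the first stop is reached at time `t` with charge `b`, all later stops are reached at a
time in `[0, T]` and with a charge in `[0, B]`. -/
def FeasibleFrom : ℝ → ℝ → Path V → Prop
  | t, b, x :: y :: l =>
      I.nextTime t x y.1 ∈ Set.Icc 0 I.T ∧ I.nextCharge b x y.1 ∈ Set.Icc 0 I.B ∧
        FeasibleFrom (I.nextTime t x y.1) (I.nextCharge b x y.1) (y :: l)
  | _, _, _ => True

/-- Partial paths: they start in a depot, follow arcs, meet no depot strictly in between, and have
a nonnegative charging time at the charging stations other than the last node. -/
structure IsPartialPath (p : Path V) : Prop where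
  chain : (nodes p).IsChain I.arc
  start : ∃ n, (nodes p).head? = some n ∧ I.kind n = NodeKind.depot
  interior : ∀ n ∈ (nodes p).tail.dropLast, I.kind n ≠ NodeKind.depot
  charge_nonneg : ∀ x ∈ p, 0 ≤ x.2
  charge_only : ∀ (k : ℕ) (x : V × ℝ), p[k]? = some x → x.2 ≠ 0 →
    I.kind x.1 = NodeKind.charger ∧ k + 1 < p.length

/-- The set `𝒫°` of feasible partial paths: time starts at `0` and charge at `B`. -/
def partialPaths : Set (Path V) :=
  {p | I.IsPartialPath p ∧ I.FeasibleFrom 0 I.B p ∧ R.Admits (nodes p)}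

/-- The path set `𝒫`: feasible partial paths with at least one arc that end in a depot. -/
def paths : Set (Path V) :=
  {p | p ∈ I.partialPaths R ∧ 2 ≤ p.length ∧
    ∃ n, (nodes p).getLast? = some n ∧ I.kind n = NodeKind.depot}

/-- The charging cost of a (partial) path. -/
def chargeCost (p : Path V) : ℝ :=
  (p.map fun x => if I.kind x.1 = NodeKind.charger then I.chargeRate x.1 * x.2 else 0).sum

/-- The cost `c^p`. -/
def pathCost (p : Path V) : ℝ := arcSum I.cost (nodes p) + I.chargeCost p

/-- The depots. -/
def depots : Finset V := Finset.univ.filter fun j => I.kind j = NodeKind.depot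

/-- The tasks. -/
def tasks : Finset V := Finset.univ.filter fun i => I.kind i = NodeKind.task

/-! ### The linear relaxation over a set of paths, its dual, and reduced costs -/

/-- Feasible solutions of the linear relaxation over the path set `Q`. A solution is a finitely
supported function on paths that vanishes outside `Q`. -/
structure IsFeasible (Q : Set (Path V)) (z : Path V →₀ ℝ) : Prop where
  support : ∀ p, z p ≠ 0 → p ∈ Q
  nonneg : ∀ p, 0 ≤ z p
  start_eq : ∀ j ∈ I.depots,
    (z.sum fun p w => if (nodes p).head? = some j then w else 0) = (I.vStart j : ℝ)
  end_ge : ∀ j ∈ I.depots,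
    (I.vEnd j : ℝ) ≤ z.sum fun p w => if (nodes p).getLast? = some j then w else 0
  serve_eq : ∀ i ∈ I.tasks, (z.sum fun p w => ((nodes p).count i : ℝ) * w) = 1

/-- The objective value of a solution of the relaxation. -/
def objective (z : Path V →₀ ℝ) : ℝ := z.sum fun p w => I.pathCost p * w

/-- Optimal solutions of the linear relaxation over the path set `Q`. -/
def IsOptimal (Q : Set (Path V)) (z : Path V →₀ ℝ) : Prop :=
  I.IsFeasible Q z ∧ ∀ z', I.IsFeasible Q z' → I.objective z ≤ I.objective z'

/-- The reduced cost of a path. -/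
def reducedCost (d : Duals V) (p : Path V) : ℝ :=
  I.pathCost p
    - (∑ j ∈ I.depots, if (nodes p).head? = some j then d.κ j else 0)
    - (∑ j ∈ I.depots, if (nodes p).getLast? = some j then d.μ j else 0)
    - ∑ i ∈ I.tasks, ((nodes p).count i : ℝ) * d.ν i

/-- Feasible solutions of the dual of the relaxation over `Q`. -/
def IsDualFeasible (Q : Set (Path V)) (d : Duals V) : Prop :=
  (∀ j ∈ I.depots, 0 ≤ d.μ j) ∧ ∀ p ∈ Q, 0 ≤ I.reducedCost d p

/-- The objective value of the dual. -/
def dualObjective (d : Duals V) : ℝ :=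
  (∑ j ∈ I.depots, (I.vStart j : ℝ) * d.κ j) + (∑ j ∈ I.depots, (I.vEnd j : ℝ) * d.μ j)
    + ∑ i ∈ I.tasks, d.ν i

/-- Optimal solutions of the dual of the relaxation over `Q`. -/
def IsDualOptimal (Q : Set (Path V)) (d : Duals V) : Prop :=
  I.IsDualFeasible Q d ∧ ∀ d', I.IsDualFeasible Q d' → I.dualObjective d' ≤ I.dualObjective d

/-! ### Subpaths -/

/-- Partial subpaths: they start in a depot or charging station, follow arcs, and visit only tasks
strictly in between. -/
structure IsPartialSubpath (s : List V) : Prop where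
  chain : s.IsChain I.arc
  start : ∃ n, s.head? = some n ∧ I.kind n ≠ NodeKind.task
  interior : ∀ n ∈ s.tail.dropLast, I.kind n = NodeKind.task

/-- The set `𝒮°` of feasible partial subpaths. -/
def partialSubpaths : Set (List V) :=
  {s | I.IsPartialSubpath s ∧ arcSum I.time s ∈ Set.Icc 0 I.T ∧
    arcSum I.energy s ∈ Set.Icc 0 I.B ∧ R.Admits s}

/-- A partial subpath is a subpath if it has at least one arc and ends in a depot or charging
station. -/
def EndsSubpath (s : List V) : Prop :=
  2 ≤ s.length ∧ ∃ n, s.getLast? = some n ∧ I.kind n ≠ NodeKind.task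

/-- The set `𝒮` of feasible subpaths. -/
def subpaths : Set (List V) := {s | s ∈ I.partialSubpaths R ∧ I.EndsSubpath s}

/-- The reduced cost contribution of a partial subpath. -/
def subpathRC (d : Duals V) (s : List V) : ℝ :=
  arcSum (fun u v => I.cost u v - if I.kind v = NodeKind.task then d.ν v else 0) s
    - (∑ j ∈ I.depots, if s.head? = some j then d.κ j else 0)
    - ∑ j ∈ I.depots, if s.getLast? = some j then d.μ j else 0

/-! ### Subpath sequences -/

/-- Subpath sequences: nonempty sequences of feasible subpaths, starting in a depot, in which
consecutive subpaths meet in a charging station. -/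
structure IsSubpathSeq (σ : List (List V)) : Prop where
  ne_nil : σ ≠ []
  mem : ∀ s ∈ σ, s ∈ I.subpaths R
  start : ∃ n, (joinNodes σ).head? = some n ∧ I.kind n = NodeKind.depot
  link : σ.IsChain fun s s' =>
    ∃ r, s.getLast? = some r ∧ s'.head? = some r ∧ I.kind r = NodeKind.charger

/-- The set `𝒫°(σ)` of feasible partial paths with subpath sequence `σ`. -/
def partialPathsOf (σ : List (List V)) : Set (Path V) :=
  {p | p ∈ I.partialPaths R ∧ nodes p = joinNodes σ}

/-- The set of feasible subpath sequences. -/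
def subpathSeqs : Set (List (List V)) :=
  {σ | I.IsSubpathSeq R σ ∧ (I.partialPathsOf R σ).Nonempty}

/-- A subpath sequence is complete if it ends in a depot. -/
def IsComplete (σ : List (List V)) : Prop :=
  ∃ n, (joinNodes σ).getLast? = some n ∧ I.kind n = NodeKind.depot

/-- The reduced cost contribution of a partial path `p` with subpath sequence `σ`. -/
def pathRC (d : Duals V) (σ : List (List V)) (p : Path V) : ℝ :=
  (σ.map (I.subpathRC d)).sum + I.chargeCost p

/-- `p` is a minimal partial path of `σ`: a feasible partial path with subpath sequence `σ` of
minimum reduced cost contribution. -/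
def IsMinimalPath (d : Duals V) (σ : List (List V)) (p : Path V) : Prop :=
  p ∈ I.partialPathsOf R σ ∧ ∀ q ∈ I.partialPathsOf R σ, I.pathRC d σ p ≤ I.pathRC d σ q

end Instance

/-! ### Domination criteria -/

/-- Vectors of non-domination and domination criteria on the labels `L`. -/
structure Criteria (L α ι : Type*) where
  ND : L → α
  D : L → ι → ℝ

/-- `x` dominates `y`. -/
def Criteria.Dominates {L α ι : Type*} (C : Criteria L α ι) (x y : L) : Prop :=
  C.ND x = C.ND y ∧ ∀ k, C.D x k ≤ C.D y k

/-- The ingredients of the two-level label-setting algorithm, which may depend on the dual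
variables: the criteria for subpaths and for subpath sequences, and the time stamps by which the
next label is selected. -/
structure LabelData (V α ι β ι' : Type*) where
  sub : Duals V → Criteria (List V) α ι
  seq : Duals V → Criteria (List (List V)) β ι'
  subStamp : Duals V → List V → ℝ
  seqStamp : Duals V → List (List V) → ℝ

namespace LabelData

variable {V α ι β ι' : Type*} [Fintype V] [DecidableEq V] (A : LabelData V α ι β ι')
  (I : Instance V) (R : SequenceRule V) (d : Duals V)

/-- The non-domination criteria determine the starting and the ending node. -/
structure RecordsEndpoints : Prop where
  sub : ∀ s₁ ∈ I.partialSubpaths R, ∀ s₂ ∈ I.partialSubpaths R,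
    (A.sub d).ND s₁ = (A.sub d).ND s₂ →
      s₁.head? = s₂.head? ∧ s₁.getLast? = s₂.getLast?
  seq : ∀ σ₁ ∈ I.subpathSeqs R, ∀ σ₂ ∈ I.subpathSeqs R,
    (A.seq d).ND σ₁ = (A.seq d).ND σ₂ →
      (joinNodes σ₁).head? = (joinNodes σ₂).head? ∧
        (joinNodes σ₁).getLast? = (joinNodes σ₂).getLast?

/-- Domination criteria for subpaths: domination propagates along arcs. -/
def SubpathDomination : Prop :=
  ∀ s₁ ∈ I.partialSubpaths R, ∀ s₂ ∈ I.partialSubpaths R, (A.sub d).Dominates s₁ s₂ →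
    ∀ u v, s₁.getLast? = some u → s₂.getLast? = some u → I.arc u v →
      s₂ ++ [v] ∉ I.partialSubpaths R ∨
        (s₁ ++ [v] ∈ I.partialSubpaths R ∧ s₂ ++ [v] ∈ I.partialSubpaths R ∧
          (A.sub d).Dominates (s₁ ++ [v]) (s₂ ++ [v]))

/-- Domination criteria for subpath sequences: domination propagates (i) from a sequence to its
extensions by a subpath, and (ii) from a subpath to the extensions by it of a sequence, where the
sequence may be empty. -/
structure SeqDomination : Prop where
  right : ∀ σ₁ ∈ I.subpathSeqs R, ∀ σ₂ ∈ I.subpathSeqs R, (A.seq d).Dominates σ₁ σ₂ →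
    ∀ s ∈ I.subpaths R,
      (joinNodes σ₁).getLast? = s.head? → (joinNodes σ₂).getLast? = s.head? →
        σ₂ ++ [s] ∉ I.subpathSeqs R ∨
          (σ₁ ++ [s] ∈ I.subpathSeqs R ∧ σ₂ ++ [s] ∈ I.subpathSeqs R ∧
            (A.seq d).Dominates (σ₁ ++ [s]) (σ₂ ++ [s]))
  left : ∀ s₁ ∈ I.subpaths R, ∀ s₂ ∈ I.subpaths R, (A.sub d).Dominates s₁ s₂ →
    ∀ σ, σ = [] ∨ (σ ∈ I.subpathSeqs R ∧ (joinNodes σ).getLast? = s₁.head? ∧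
          (joinNodes σ).getLast? = s₂.head?) →
        σ ++ [s₂] ∉ I.subpathSeqs R ∨
          (σ ++ [s₁] ∈ I.subpathSeqs R ∧ σ ++ [s₂] ∈ I.subpathSeqs R ∧
            (A.seq d).Dominates (σ ++ [s₁]) (σ ++ [s₂]))

/-- Termination criteria for subpaths: one component is the reduced cost contribution, and one
component is nonnegative, bounded, and strictly increasing along extensions. -/
structure SubpathTermination : Prop where
  reducedCost : ∃ k, ∀ s ∈ I.partialSubpaths R, (A.sub d).D s k = I.subpathRC d s
  resource : ∃ k, ∃ M : ℝ,
    (∀ s ∈ I.partialSubpaths R, 0 ≤ (A.sub d).D s k ∧ (A.sub d).D s k ≤ M) ∧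
    ∀ s ∈ I.partialSubpaths R, ∀ v, s ++ [v] ∈ I.partialSubpaths R →
      (A.sub d).D s k < (A.sub d).D (s ++ [v]) k

/-- Termination criteria for subpath sequences: one component is the reduced cost contribution of
the minimal path, and one component is nonnegative, bounded, and strictly increasing along
extensions. -/
structure SeqTermination : Prop where
  reducedCost : ∃ k, ∀ σ ∈ I.subpathSeqs R, ∀ p, I.IsMinimalPath R d σ p →
    (A.seq d).D σ k = I.pathRC d σ p
  mono : ∀ σ₁ ∈ I.subpathSeqs R, ∀ σ₂ ∈ I.subpathSeqs R, (A.seq d).Dominates σ₁ σ₂ →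
    ∀ p₁ p₂, I.IsMinimalPath R d σ₁ p₁ → I.IsMinimalPath R d σ₂ p₂ →
      I.pathRC d σ₁ p₁ ≤ I.pathRC d σ₂ p₂
  resource : ∃ k, ∃ M : ℝ,
    (∀ σ ∈ I.subpathSeqs R, 0 ≤ (A.seq d).D σ k ∧ (A.seq d).D σ k ≤ M) ∧
    ∀ σ ∈ I.subpathSeqs R, ∀ s, σ ++ [s] ∈ I.subpathSeqs R →
      (A.seq d).D σ k < (A.seq d).D (σ ++ [s]) k

end LabelData

/-! ### Label setting -/

/-- The state of a label-setting procedure: the queue, and the labels generated so far. -/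
structure LabelState (L : Type*) where
  queue : Set L
  gen : Set L

/-- What specifies a label-setting procedure: the feasible labels, the pruning relation
(`prunes x y`: the presence of `x` makes `y` superfluous), the time stamp, the labels that are not
extended further, and the candidate extensions of a label. -/
structure LabelProc (L : Type*) where
  feasible : Set L
  prunes : L → L → Prop
  stamp : L → ℝ
  final : L → Prop
  extensions : L → Set L

open Classical in
/-- Treatment of one candidate `x`, where `gen` is the set of generated labels and `queue` the
current queue. The candidate is dropped if it is infeasible or pruned; otherwise the labels that it
prunes leave the queue, and it enters the queue. -/
def LabelProc.insert {L : Type*} (A : LabelProc L) (gen queue : Set L) (x : L) : Set L :=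
  if x ∉ A.feasible ∨ ∃ y ∈ queue ∪ gen, A.prunes y x then queue
  else {y ∈ queue | ¬ A.prunes x y} ∪ {x}

/-- One iteration: a label with the smallest time stamp moves from the queue to the generated
labels, and if it is not final, its extensions are treated one after the other, in any order. -/
inductive LabelProc.Step {L : Type*} (A : LabelProc L) : LabelState L → LabelState L → Prop
  | final (S : LabelState L) (x : L) (hx : x ∈ S.queue)
      (hmin : ∀ y ∈ S.queue, A.stamp x ≤ A.stamp y) (hf : A.final x) :
      LabelProc.Step A S ⟨S.queue \ {x}, S.gen ∪ {x}⟩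
  | extend (S : LabelState L) (x : L) (hx : x ∈ S.queue)
      (hmin : ∀ y ∈ S.queue, A.stamp x ≤ A.stamp y) (hf : ¬ A.final x)
      (order : List L) (hnodup : order.Nodup) (horder : ∀ y, y ∈ order ↔ y ∈ A.extensions x) :
      LabelProc.Step A S
        ⟨order.foldl (A.insert (S.gen ∪ {x})) (S.queue \ {x}), S.gen ∪ {x}⟩

namespace LabelData

variable {V α ι β ι' : Type*} [Fintype V] [DecidableEq V] (A : LabelData V α ι β ι')
  (I : Instance V) (R : SequenceRule V) (d : Duals V)

/-- First level: partial subpaths are extended along arcs. A single-node label, which is only the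
seed of the partial subpaths that start there, prunes no other label. -/
def subProc : LabelProc (List V) where
  feasible := I.partialSubpaths R
  prunes x y := 2 ≤ x.length ∧ (A.sub d).Dominates x y
  stamp := A.subStamp d
  final := I.EndsSubpath
  extensions s := {s' | ∃ u v, s.getLast? = some u ∧ I.arc u v ∧ s' = s ++ [v]}

/-- First-level initialization: the queue holds the single-node partial subpaths. -/
def subInit : LabelState (List V) where
  queue := {s | ∃ n, I.kind n ≠ NodeKind.task ∧ s = [n]}
  gen := ∅

/-- Second level: subpath sequences are extended along the subpaths in `Sstar`. -/
def seqProc (Sstar : Set (List V)) : LabelProc (List (List V)) where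
  feasible := I.subpathSeqs R
  prunes := (A.seq d).Dominates
  stamp := A.seqStamp d
  final := I.IsComplete
  extensions σ := {σ' | ∃ s ∈ Sstar, s.head? = (joinNodes σ).getLast? ∧ σ' = σ ++ [s]}

/-- Second-level initialization: the queue holds the one-element sequences from `Sstar` that start
in a depot. -/
def seqInit (Sstar : Set (List V)) : LabelState (List (List V)) where
  queue := {σ | ∃ s ∈ Sstar, (∃ n, s.head? = some n ∧ I.kind n = NodeKind.depot) ∧ σ = [s]}
  gen := ∅

end LabelData

/-! ### Column generation -/

/-- The states of column generation: about to solve the master problem over the current path set;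
running the first or the second level of the pricing algorithm with the current path set `P`, the
optimal master solution `z` and the dual solution `d`; or stopped with the solution `z`. -/
inductive CGState (V : Type*) where
  | master (P : Set (Path V))
  | firstLevel (P : Set (Path V)) (z : Path V →₀ ℝ) (d : Duals V) (S : LabelState (List V))
  | secondLevel (P : Set (Path V)) (z : Path V →₀ ℝ) (d : Duals V) (Sstar : Set (List V))
      (S : LabelState (List (List V)))
  | stopped (z : Path V →₀ ℝ)

/-- `Pnew` is a possible outcome of pricing when the second level has generated the subpath
sequences `gen`: for every complete one, one minimal path is computed, and those with negative
reduced cost are kept. -/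
def IsPricingOutcome {V : Type*} [Fintype V] [DecidableEq V] (I : Instance V) (R : SequenceRule V)
    (d : Duals V) (gen : Set (List (List V))) (Pnew : Set (Path V)) : Prop :=
  ∃ minPath : List (List V) → Path V,
    (∀ σ ∈ gen, I.IsComplete σ → I.IsMinimalPath R d σ (minPath σ)) ∧
    Pnew = {p | (∃ σ ∈ gen, I.IsComplete σ ∧ p = minPath σ) ∧ I.reducedCost d p < 0}

/-- The steps of column generation with the two-level label-setting pricing algorithm. -/
inductive CGStep {V α ι β ι' : Type*} [Fintype V] [DecidableEq V] (I : Instance V)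
    (R : SequenceRule V) (A : LabelData V α ι β ι') : CGState V → CGState V → Prop
  /-- Solve the master problem and its dual, and start the first level. -/
  | solve (P : Set (Path V)) (z : Path V →₀ ℝ) (d : Duals V)
      (hz : I.IsOptimal P z) (hd : I.IsDualOptimal P d) :
      CGStep I R A (.master P) (.firstLevel P z d (LabelData.subInit I))
  /-- Iterate in the first level. -/
  | first (P : Set (Path V)) (z : Path V →₀ ℝ) (d : Duals V) (S S' : LabelState (List V))
      (h : (A.subProc I R d).Step S S') :
      CGStep I R A (.firstLevel P z d S) (.firstLevel P z d S')
  /-- The queue of the first level is empty: pass the generated subpaths to the second level. -/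
  | toSecond (P : Set (Path V)) (z : Path V →₀ ℝ) (d : Duals V) (S : LabelState (List V))
      (h : S.queue = ∅) :
      CGStep I R A (.firstLevel P z d S)
        (.secondLevel P z d {s ∈ S.gen | I.EndsSubpath s}
          (LabelData.seqInit I {s ∈ S.gen | I.EndsSubpath s}))
  /-- Iterate in the second level. -/
  | second (P : Set (Path V)) (z : Path V →₀ ℝ) (d : Duals V) (Sstar : Set (List V))
      (S S' : LabelState (List (List V))) (h : (A.seqProc I R d Sstar).Step S S') :
      CGStep I R A (.secondLevel P z d Sstar S) (.secondLevel P z d Sstar S')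
  /-- The queue of the second level is empty, and paths of negative reduced cost were found. -/
  | addPaths (P : Set (Path V)) (z : Path V →₀ ℝ) (d : Duals V) (Sstar : Set (List V))
      (S : LabelState (List (List V))) (h : S.queue = ∅) (Pnew : Set (Path V))
      (hP : IsPricingOutcome I R d S.gen Pnew) (hne : Pnew ≠ ∅) :
      CGStep I R A (.secondLevel P z d Sstar S) (.master (P ∪ Pnew))
  /-- The queue of the second level is empty, and no path of negative reduced cost was found. -/
  | finish (P : Set (Path V)) (z : Path V →₀ ℝ) (d : Duals V) (Sstar : Set (List V))
      (S : LabelState (List (List V))) (h : S.queue = ∅)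
      (hP : IsPricingOutcome I R d S.gen ∅) :
      CGStep I R A (.secondLevel P z d Sstar S) (.stopped z)

/-- Every execution from `a` comes to a halt after finitely many steps in a state with `halted`:
there is no infinite execution, and no execution gets stuck in any other state. -/
def Terminates {α : Type*} (step : α → α → Prop) (halted : α → Prop) (a : α) : Prop :=
  (¬ ∃ f : ℕ → α, f 0 = a ∧ ∀ n, step (f n) (f (n + 1))) ∧
    ∀ b, Relation.ReflTransGen step a b → ¬ halted b → ∃ c, step b c

/-- The stopped states. -/
def CGState.IsStopped {V : Type*} (S : CGState V) : Prop := ∃ z, S = .stopped z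

end ERSP

end

/-! Charging times are real numbers, so there may be a continuum of paths; finiteness has to come
from node sequences. Arc times have a positive minimum and the horizon is finite, so only finitely
many node sequences fit into it. Hence there are finitely many partial subpaths and finitely many
feasible subpath sequences (`finite_partialSubpaths`, `finite_subpathSeqs`). For fixed nodes the
admissible charging times form a compact set, so minimal paths exist (`exists_min_chargeCost`).

Label setting loses nothing up to domination. A pruned label always has a pruner among the current
labels, and transitivity keeps this true when the pruner is itself removed (`Inv.step`). Once the
queue is empty, every feasible extension of a generated non-final label is therefore dominated by a
generated one. Since domination propagates along extensions, induction on the length shows that the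
first level dominates every subpath (`exists_subpath_dominates`) and the second level every feasible
subpath sequence (`exists_seq_gen_dominates`). Every path splits into a subpath sequence, and its
contribution is its reduced cost (`exists_subpathSeq`, `pathRC_eq_reducedCost`). So if some path has
negative reduced cost, pricing finds one (`IsPricingOutcome.reducedCost_nonneg`).

When pricing finds none, the dual solution of the finite master problem is feasible for the dual
over all paths. Strong duality for the finite problem, obtained from `farkas`, and weak duality for
the semi-infinite one then give optimality (`isOptimal_of_reducedCost_nonneg`).

For termination, each label-setting step generates a new label from a finite set (`Step.ncard_lt`).
Each round that adds paths adds one that is cheapest for its node sequence, while dual feasibility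
shows that the old path set had no cheapest path for these nodes
(`IsPricingOutcome.ncard_uncovered_lt`). The number of node sequences without a cheapest path thus
drops in every round, and a lexicographic measure combines the counts. -/

namespace ERSP

/-! ### Label setting -/

namespace LabelProc

variable {L : Type*} (A : LabelProc L)

/-- The label `y` is present in `W` or pruned by a label in `W`. -/
def Covered (W : Set L) (y : L) : Prop := ∃ w ∈ W, A.prunes w y

variable {A}

lemma insert_subset (g q : Set L) (x : L) :
    A.insert g q x ⊆ q ∪ {y | y = x ∧ y ∈ A.feasible} := by
  unfold insert
  split_ifs with h
  · exact Set.subset_union_left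
  · push Not at h
    rintro y (hy | hy)
    · exact Or.inl hy.1
    · rw [Set.mem_singleton_iff] at hy
      subst hy
      exact Or.inr ⟨rfl, h.1⟩

/-- If the witness is thrown out of the queue, the label that threw it out takes over, by
transitivity. -/
lemma covered_insert_of_covered (htrans : ∀ x y z, A.prunes x y → A.prunes y z → A.prunes x z)
    {g q : Set L} {x y : L} (h : A.Covered (q ∪ g) y) :
    A.Covered (A.insert g q x ∪ g) y := by
  obtain ⟨w, hw, hwy⟩ := h
  unfold insert
  split_ifs with hc
  · exact ⟨w, hw, hwy⟩
  · rcases hw with hw | hw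
    · by_cases hxw : A.prunes x w
      · exact ⟨x, Or.inl (Or.inr rfl), htrans _ _ _ hxw hwy⟩
      · exact ⟨w, Or.inl (Or.inl ⟨hw, hxw⟩), hwy⟩
    · exact ⟨w, Or.inr hw, hwy⟩

lemma covered_insert_self {g q : Set L} {x : L} (hx : A.prunes x x) (hf : x ∈ A.feasible) :
    A.Covered (A.insert g q x ∪ g) x := by
  unfold insert
  split_ifs with hc
  · rcases hc with hc | ⟨y, hy, hyx⟩
    · exact absurd hf hc
    · exact ⟨y, hy, hyx⟩
  · exact ⟨x, Or.inl (Or.inr rfl), hx⟩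

/-- This serves initial labels, which need not prune themselves: while such a label stays in the
queue, membership is all that is known about it. -/
lemma mem_or_covered_insert {g q : Set L} {x y : L} (h : y ∈ q) :
    y ∈ A.insert g q x ∨ A.Covered (A.insert g q x ∪ g) y := by
  unfold insert
  split_ifs with hc
  · exact Or.inl h
  · by_cases hxy : A.prunes x y
    · exact Or.inr ⟨x, Or.inl (Or.inr rfl), hxy⟩
    · exact Or.inl (Or.inl ⟨h, hxy⟩)

/-- A candidate that has already been generated is pruned by itself, so it cannot return to the
queue. This is why no label is generated twice. -/
lemma disjoint_insert {g q : Set L} {x : L} (hx : A.prunes x x) (h : Disjoint q g) :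
    Disjoint (A.insert g q x) g := by
  unfold insert
  split_ifs with hc
  · exact h
  · push Not at hc
    rw [Set.disjoint_left] at h ⊢
    rintro y (hy | hy) hyg
    · exact h hy.1 hyg
    · rw [Set.mem_singleton_iff] at hy
      subst hy
      exact hc.2 y (Or.inr hyg) hx

section foldl

variable (htrans : ∀ x y z, A.prunes x y → A.prunes y z → A.prunes x z)

lemma foldl_insert_subset (g : Set L) (l : List L) (q : Set L) :
    l.foldl (A.insert g) q ⊆ q ∪ A.feasible := by
  induction l generalizing q with
  | nil => exact Set.subset_union_left
  | cons x l ih =>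
    refine (ih _).trans (Set.union_subset ((insert_subset g q x).trans ?_) Set.subset_union_right)
    exact Set.union_subset_union_right _ fun y hy => hy.2

lemma disjoint_foldl_insert {g : Set L} (l : List L) (hl : ∀ x ∈ l, A.prunes x x) {q : Set L}
    (h : Disjoint q g) : Disjoint (l.foldl (A.insert g) q) g := by
  induction l generalizing q with
  | nil => exact h
  | cons x l ih =>
    exact ih (fun y hy => hl y (by simp [hy])) (disjoint_insert (hl x (by simp)) h)

include htrans in
lemma covered_foldl_insert_of_covered {g : Set L} (l : List L) (hl : ∀ x ∈ l, A.prunes x x)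
    {q : Set L} {y : L} (h : A.Covered (q ∪ g) y) :
    A.Covered (l.foldl (A.insert g) q ∪ g) y := by
  induction l generalizing q with
  | nil => exact h
  | cons x l ih =>
    exact ih (fun y hy => hl y (by simp [hy]))
      (covered_insert_of_covered htrans h)

include htrans in
lemma mem_or_covered_foldl_insert {g : Set L} (l : List L) (hl : ∀ x ∈ l, A.prunes x x)
    {q : Set L} {y : L} (h : y ∈ q) :
    y ∈ l.foldl (A.insert g) q ∨ A.Covered (l.foldl (A.insert g) q ∪ g) y := by
  induction l generalizing q with
  | nil => exact Or.inl h
  | cons x l ih =>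
    have hl' : ∀ z ∈ l, A.prunes z z := fun z hz => hl z (by simp [hz])
    rcases mem_or_covered_insert (A := A) (g := g) (x := x) h with h | h
    · exact ih hl' h
    · exact Or.inr (covered_foldl_insert_of_covered htrans l hl' h)

include htrans in
lemma covered_foldl_insert_of_mem {g : Set L} (l : List L) (hl : ∀ x ∈ l, A.prunes x x)
    {q : Set L} {y : L} (h : y ∈ l) (hy : y ∈ A.feasible) :
    A.Covered (l.foldl (A.insert g) q ∪ g) y := by
  induction l generalizing q with
  | nil => simp at h
  | cons x l ih =>
    have hl' : ∀ z ∈ l, A.prunes z z := fun z hz => hl z (by simp [hz])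
    rcases List.mem_cons.1 h with rfl | h
    · exact covered_foldl_insert_of_covered htrans l hl'
        (covered_insert_self (hl y (by simp)) hy)
    · exact ih hl' h

end foldl

variable (A) in
/-- The invariants of label setting started from the queue `init`: all labels are initial or
feasible, no label is generated twice, every feasible extension of a generated label is pruned by
a current label, and every initial label is a current label or pruned by one. -/
structure Inv (init : Set L) (S : LabelState L) : Prop where
  queue_subset : S.queue ⊆ init ∪ A.feasible
  gen_subset : S.gen ⊆ init ∪ A.feasible
  disj : Disjoint S.queue S.gen
  closed : ∀ x ∈ S.gen, ¬ A.final x → ∀ y ∈ A.extensions x, y ∈ A.feasible →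
    A.Covered (S.queue ∪ S.gen) y
  init_covered : ∀ x ∈ init, x ∈ S.queue ∪ S.gen ∨ A.Covered (S.queue ∪ S.gen) x

lemma Inv.start (init : Set L) : A.Inv init ⟨init, ∅⟩ where
  queue_subset := Set.subset_union_left
  gen_subset := Set.empty_subset _
  disj := Set.disjoint_empty _
  closed := by simp
  init_covered x hx := Or.inl (Or.inl hx)

/-- Reflexivity of pruning is demanded only for extensions, because the single-node seeds of the
first level do not prune themselves. -/
lemma Inv.step (htrans : ∀ x y z, A.prunes x y → A.prunes y z → A.prunes x z)
    (hrefl : ∀ x, ∀ y ∈ A.extensions x, A.prunes y y) {init : Set L} {S S' : LabelState L}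
    (hS : A.Inv init S) (h : A.Step S S') : A.Inv init S' := by
  cases h with
  | final x hx hmin hf =>
    have e : S.queue \ {x} ∪ (S.gen ∪ {x}) = S.queue ∪ S.gen := by
      ext y
      by_cases hy : y = x
      · subst hy; simp [hx]
      · simp [hy]
    refine ⟨Set.sdiff_subset.trans hS.queue_subset,
      Set.union_subset hS.gen_subset (by simpa using hS.queue_subset hx), ?_, ?_, ?_⟩
    · have := hS.disj
      rw [Set.disjoint_left] at this ⊢
      rintro y ⟨hy, hyx⟩ (hy' | hy')
      exacts [this hy hy', hyx hy']
    · rintro y (hy | rfl) hfy z hz hzf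
      · rw [e]; exact hS.closed y hy hfy z hz hzf
      · exact absurd hf hfy
    · rw [e]; exact hS.init_covered
  | extend x hx hmin hf order hnodup horder =>
    have hl : ∀ y ∈ order, A.prunes y y := fun y hy => hrefl x y ((horder y).1 hy)
    have e : S.queue \ {x} ∪ (S.gen ∪ {x}) = S.queue ∪ S.gen := by
      ext y
      by_cases hy : y = x
      · subst hy; simp [hx]
      · simp [hy]
    have hd : Disjoint (S.queue \ {x}) (S.gen ∪ {x}) := by
      have := hS.disj
      rw [Set.disjoint_left] at this ⊢
      rintro y ⟨hy, hyx⟩ (hy' | hy')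
      exacts [this hy hy', hyx hy']
    have hcov : ∀ y, A.Covered (S.queue ∪ S.gen) y → A.Covered
        (order.foldl (A.insert (S.gen ∪ {x})) (S.queue \ {x}) ∪ (S.gen ∪ {x})) y := fun y hy =>
      covered_foldl_insert_of_covered htrans order hl (by rwa [e])
    refine ⟨?_, Set.union_subset hS.gen_subset (by simpa using hS.queue_subset hx),
      disjoint_foldl_insert order hl hd, ?_, ?_⟩
    · exact (foldl_insert_subset _ _ _).trans (Set.union_subset
        (Set.sdiff_subset.trans hS.queue_subset) Set.subset_union_right)
    · rintro y (hy | rfl) hfy z hz hzf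
      · exact hcov z (hS.closed y hy hfy z hz hzf)
      · exact covered_foldl_insert_of_mem htrans order hl ((horder z).2 hz) hzf
    · intro y hy
      rcases hS.init_covered y hy with h | h
      · rw [← e] at h
        rcases h with h | h
        · rcases mem_or_covered_foldl_insert htrans (g := S.gen ∪ {x}) order hl h with h | h
          · exact Or.inl (Or.inl h)
          · exact Or.inr h
        · exact Or.inl (Or.inr h)
      · exact Or.inr (hcov y h)

/-- The label that leaves the queue lies in the finite universe `U` and, by disjointness of queue
and generated labels, is newly generated. -/
lemma Step.ncard_lt {init U : Set L} (hU : U.Finite) (hinit : init ∪ A.feasible ⊆ U)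
    {S S' : LabelState L} (hS : A.Inv init S) (h : A.Step S S') :
    (U \ S'.gen).ncard < (U \ S.gen).ncard := by
  have key : ∀ x ∈ S.queue, (U \ (S.gen ∪ {x})).ncard < (U \ S.gen).ncard := by
    intro x hx
    refine Set.ncard_lt_ncard ?_ (hU.subset Set.sdiff_subset)
    refine ⟨fun y hy => ⟨hy.1, fun h => hy.2 (Or.inl h)⟩, fun hsub => ?_⟩
    have := hsub ⟨hinit (hS.queue_subset hx), Set.disjoint_left.1 hS.disj hx⟩
    exact this.2 (Or.inr rfl)
  cases h with
  | final x hx => exact key x hx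
  | extend x hx => exact key x hx

lemma exists_step {S : LabelState L} (hfin : S.queue.Finite) (hne : S.queue.Nonempty)
    (hext : ∀ x, (A.extensions x).Finite) : ∃ S', A.Step S S' := by
  obtain ⟨x, hx, hmin⟩ := Set.exists_min_image S.queue A.stamp hfin hne
  by_cases hf : A.final x
  · exact ⟨_, Step.final S x hx hmin hf⟩
  · exact ⟨_, Step.extend S x hx hmin hf (hext x).toFinset.toList (Finset.nodup_toList _)
      (by simp)⟩

end LabelProc

/-! ### Sums along arcs -/

section Lists

variable {V : Type*}

@[simp] lemma arcSum_nil (f : V → V → ℝ) : arcSum f [] = 0 := rfl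

@[simp] lemma arcSum_singleton (f : V → V → ℝ) (u : V) : arcSum f [u] = 0 := rfl

@[simp] lemma arcSum_cons_cons (f : V → V → ℝ) (u v : V) (l : List V) :
    arcSum f (u :: v :: l) = f u v + arcSum f (v :: l) := rfl

lemma arcSum_nonneg {r : V → V → Prop} {f : V → V → ℝ} (hf : ∀ u v, r u v → 0 ≤ f u v) :
    ∀ l : List V, l.IsChain r → 0 ≤ arcSum f l
  | [], _ => le_rfl
  | [_], _ => le_rfl
  | u :: v :: l, h => by
    rw [List.isChain_cons_cons] at h
    rw [arcSum_cons_cons]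
    exact add_nonneg (hf _ _ h.1) (arcSum_nonneg hf _ h.2)

/-- The arc sum splits at a node. -/
lemma arcSum_append_cons (f : V → V → ℝ) (x : V) (l' : List V) : ∀ l : List V,
    arcSum f (l ++ x :: l') = arcSum f (l ++ [x]) + arcSum f (x :: l')
  | [] => by simp
  | [u] => by simp
  | u :: v :: l => by
    have := arcSum_append_cons f x l' (v :: l)
    simp only [List.cons_append, arcSum_cons_cons] at this ⊢
    rw [this, add_assoc]

lemma arcSum_le_append_left {r : V → V → Prop} {f : V → V → ℝ} (hf : ∀ u v, r u v → 0 ≤ f u v)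
    {l l' : List V} (h : (l ++ l').IsChain r) : arcSum f l ≤ arcSum f (l ++ l') := by
  rcases List.eq_nil_or_concat l with rfl | ⟨l, x, rfl⟩
  · simpa using arcSum_nonneg hf _ h
  · simp only [List.concat_eq_append, List.append_assoc, List.singleton_append] at h ⊢
    rw [arcSum_append_cons f x l']
    have := arcSum_nonneg hf (x :: l') (List.IsChain.right_of_append h)
    linarith

lemma arcSum_le_append_right {r : V → V → Prop} {f : V → V → ℝ} (hf : ∀ u v, r u v → 0 ≤ f u v)
    {l l' : List V} (h : (l ++ l').IsChain r) : arcSum f l' ≤ arcSum f (l ++ l') := by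
  cases l' with
  | nil => simpa using arcSum_nonneg hf _ h
  | cons x l' =>
    rw [arcSum_append_cons f x l']
    have : (l ++ [x]).IsChain r := h.prefix ⟨l', by simp⟩
    have := arcSum_nonneg hf _ this
    linarith

lemma arcSum_le_of_infix {r : V → V → Prop} {f : V → V → ℝ} (hf : ∀ u v, r u v → 0 ≤ f u v)
    {l l' : List V} (h : l <:+: l') (hl' : l'.IsChain r) : arcSum f l ≤ arcSum f l' := by
  obtain ⟨a, b, rfl⟩ := h
  exact (arcSum_le_append_right hf (hl'.left_of_append)).trans (arcSum_le_append_left hf hl')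

/-- A chain has one arc fewer than nodes. The empty list is set apart because its `length - 1` is
`-1` and nothing is assumed about the sign of `ε`. -/
lemma mul_length_le_arcSum {r : V → V → Prop} {f : V → V → ℝ} {ε : ℝ}
    (hf : ∀ u v, r u v → ε ≤ f u v) : ∀ l : List V, l.IsChain r →
      ε * ((l.length : ℝ) - 1) ≤ arcSum f l ∨ l = []
  | [], _ => Or.inr rfl
  | [_], _ => by simp
  | u :: v :: l, h => by
    rw [List.isChain_cons_cons] at h
    rw [arcSum_cons_cons]
    rcases mul_length_le_arcSum hf (v :: l) h.2 with h' | h'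
    · left
      have := hf _ _ h.1
      simp only [List.length_cons, Nat.cast_add, Nat.cast_one] at h' ⊢
      linarith
    · simp at h'

/-- Chains of arcs with a bounded sum of positive weights have bounded length. -/
lemma exists_length_bound [Finite V] {r : V → V → Prop} {f : V → V → ℝ}
    (hf : ∀ u v, r u v → 0 < f u v) (M : ℝ) :
    ∃ N : ℕ, ∀ l : List V, l.IsChain r → arcSum f l ≤ M → l.length ≤ N := by
  -- `ε` is the smallest weight among the finitely many arcs, or `1` if there is no arc.
  obtain ⟨ε, hε, hεf⟩ : ∃ ε > 0, ∀ u v, r u v → ε ≤ f u v := by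
    by_cases hne : {x : V × V | r x.1 x.2}.Nonempty
    · obtain ⟨x, hx, hmin⟩ := Set.exists_min_image _ (fun x : V × V => f x.1 x.2)
        (Set.toFinite _) hne
      exact ⟨_, hf _ _ hx, fun u v huv => hmin (u, v) huv⟩
    · refine ⟨1, one_pos, fun u v huv => absurd ⟨(u, v), huv⟩ hne⟩
  refine ⟨⌈M / ε⌉₊ + 1, fun l hl hM => ?_⟩
  rcases mul_length_le_arcSum hεf l hl with h | rfl
  · have h1 : (l.length : ℝ) - 1 ≤ M / ε := by
      rw [le_div_iff₀ hε]; linarith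
    have h2 := Nat.le_ceil (M / ε)
    have : (l.length : ℝ) ≤ ((⌈M / ε⌉₊ + 1 : ℕ) : ℝ) := by push_cast; linarith
    exact_mod_cast this
  · simp

lemma finite_lists_of_length_le {α : Type*} {S : Set α} (hS : S.Finite) (n : ℕ) :
    {l : List α | l.length ≤ n ∧ ∀ x ∈ l, x ∈ S}.Finite := by
  have : Finite S := hS
  refine ((List.finite_length_le S n).image (List.map Subtype.val)).subset ?_
  rintro l ⟨hl, hlS⟩
  exact ⟨l.attachWith (· ∈ S) hlS, by simpa using hl, by simp⟩

/-! ### Joining subpaths -/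

@[simp] lemma joinNodes_nil : joinNodes ([] : List (List V)) = [] := rfl

@[simp] lemma joinNodes_singleton (s : List V) : joinNodes [s] = s := by simp [joinNodes]

lemma joinNodes_cons (s : List V) (σ : List (List V)) :
    joinNodes (s :: σ) = s ++ (σ.map List.tail).flatten := rfl

lemma joinNodes_append_singleton {σ : List (List V)} (hσ : σ ≠ []) (s : List V) :
    joinNodes (σ ++ [s]) = joinNodes σ ++ s.tail := by
  cases σ with
  | nil => exact absurd rfl hσ
  | cons a σ => simp [joinNodes_cons]

lemma joinNodes_ne_nil {σ : List (List V)} (hσ : σ ≠ []) (h : ∀ s ∈ σ, 2 ≤ s.length) :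
    joinNodes σ ≠ [] := by
  cases σ with
  | nil => exact absurd rfl hσ
  | cons a σ =>
    have := h a (by simp)
    rw [joinNodes_cons]
    intro h0
    simp only [List.append_eq_nil_iff] at h0
    simp [h0.1] at this

lemma length_le_joinNodes {σ : List (List V)} (h : ∀ s ∈ σ, 2 ≤ s.length) :
    σ.length ≤ (joinNodes σ).length := by
  induction σ using List.reverseRecOn with
  | nil => simp
  | append_singleton σ s ih =>
    have ih := ih fun t ht => h t (by simp [ht])
    have hs := h s (by simp)
    by_cases hσ : σ = []
    · subst hσ; simp; omega
    · rw [joinNodes_append_singleton hσ]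
      simp
      omega

lemma getLast?_append_tail {l s : List V} (hs : 2 ≤ s.length) :
    (l ++ s.tail).getLast? = s.getLast? := by
  match s, hs with
  | a :: b :: s, _ => simp [List.getLast?_append, List.getLast?_cons]

lemma getLast?_joinNodes_append {σ : List (List V)} {s : List V} (hs : 2 ≤ s.length) :
    (joinNodes (σ ++ [s])).getLast? = s.getLast? := by
  by_cases hσ : σ = []
  · subst hσ; simp
  · rw [joinNodes_append_singleton hσ, getLast?_append_tail hs]

lemma head?_joinNodes_cons {s : List V} (hs : s ≠ []) (σ : List (List V)) :
    (joinNodes (s :: σ)).head? = s.head? := by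
  rw [joinNodes_cons, List.head?_append_of_ne_nil _ hs]

lemma head?_joinNodes_append {σ : List (List V)} (hσ : joinNodes σ ≠ []) (hσ' : σ ≠ [])
    (s : List V) : (joinNodes (σ ++ [s])).head? = (joinNodes σ).head? := by
  rw [joinNodes_append_singleton hσ', List.head?_append_of_ne_nil _ hσ]

lemma joinNodes_cons_cons (u v : V) (s : List V) (σ : List (List V)) :
    joinNodes ((u :: v :: s) :: σ) = u :: joinNodes ((v :: s) :: σ) := by
  simp [joinNodes_cons]

end Lists

namespace Instance

variable {V : Type*} {I : Instance V} {R : SequenceRule V}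

/-! ### Feasibility of charging schedules -/

lemma feasibleFrom_cons_cons {t b : ℝ} {x y : V × ℝ} {p : Path V} :
    I.FeasibleFrom t b (x :: y :: p) ↔
      I.nextTime t x y.1 ∈ Set.Icc 0 I.T ∧ I.nextCharge b x y.1 ∈ Set.Icc 0 I.B ∧
        I.FeasibleFrom (I.nextTime t x y.1) (I.nextCharge b x y.1) (y :: p) := Iff.rfl

/-- Charging only delays: omitting the nonnegative charging times from the last arrival time leaves
the sum of the arc times. -/
lemma FeasibleFrom.time_le : ∀ {t b : ℝ} {p : Path V}, I.FeasibleFrom t b p → t ≤ I.T →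
    (∀ x ∈ p, 0 ≤ x.2) → t + arcSum I.time (nodes p) ≤ I.T
  | t, b, [], _, h, _ => by simpa [nodes] using h
  | t, b, [x], _, h, _ => by simpa [nodes] using h
  | t, b, x :: y :: p, hf, _, hc => by
    rw [feasibleFrom_cons_cons] at hf
    have := time_le hf.2.2 hf.1.2 fun z hz => hc z (by simp [hz])
    have hx := hc x (by simp)
    simp only [nodes, List.map_cons, arcSum_cons_cons, nextTime] at this ⊢
    split_ifs at this <;> linarith

lemma FeasibleFrom.suffix : ∀ {t b : ℝ} {q r : Path V}, I.FeasibleFrom t b (q ++ r) → 0 ≤ t →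
    b ∈ Set.Icc 0 I.B → ∃ t' b', 0 ≤ t' ∧ b' ∈ Set.Icc 0 I.B ∧ I.FeasibleFrom t' b' r
  | t, b, [], r, h, ht, hb => ⟨t, b, ht, hb, h⟩
  | t, b, [x], [], _, ht, hb => ⟨t, b, ht, hb, trivial⟩
  | t, b, [x], y :: r, h, _, _ => by
    have h := feasibleFrom_cons_cons.1 h
    exact ⟨_, _, h.1.1, h.2.1, h.2.2⟩
  | t, b, x :: y :: q, r, h, _, _ => by
    have h := feasibleFrom_cons_cons.1 h
    exact suffix (q := y :: q) h.2.2 h.1.1 h.2.1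

/-- The charging time at the last stop never enters the recursion, so it can be replaced freely. -/
lemma FeasibleFrom.truncate : ∀ {t b : ℝ} {q r : Path V} {v : V} {τ τ' : ℝ},
    I.FeasibleFrom t b (q ++ (v, τ) :: r) → I.FeasibleFrom t b (q ++ [(v, τ')])
  | _, _, [], _, _, _, _, _ => trivial
  | _, _, [x], _, _, _, _, h => by
    have h := feasibleFrom_cons_cons.1 h
    exact feasibleFrom_cons_cons.2 ⟨h.1, h.2.1, trivial⟩
  | _, _, x :: y :: q, _, _, _, _, h => by
    have h := feasibleFrom_cons_cons.1 h
    exact feasibleFrom_cons_cons.2 ⟨h.1, h.2.1, truncate (q := y :: q) h.2.2⟩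

/-- Without intermediate charging, the energy use is at most the initial charge. -/
lemma FeasibleFrom.energy_le : ∀ {t b : ℝ} {p : Path V}, I.FeasibleFrom t b p → 0 ≤ b →
    (∀ n ∈ (nodes p).dropLast, I.kind n ≠ NodeKind.charger) → arcSum I.energy (nodes p) ≤ b
  | t, b, [], _, h, _ => by simpa [nodes] using h
  | t, b, [x], _, h, _ => by simpa [nodes] using h
  | t, b, x :: y :: p, hf, _, hc => by
    rw [feasibleFrom_cons_cons] at hf
    have := energy_le hf.2.2 hf.2.1.1 fun z hz => hc z (by
      simp only [nodes, List.map_cons, List.dropLast_cons_cons] at hz ⊢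
      simp [hz])
    have hx := hc x.1 (by simp [nodes])
    simp only [nodes, List.map_cons, arcSum_cons_cons, nextCharge, hx, if_false] at this ⊢
    linarith

/-- Charging may happen at the first stop, but the vehicle leaves it with at most `B`, and no charge
is added afterwards. -/
lemma FeasibleFrom.energy_le_capacity {t b : ℝ} {p : Path V} (hf : I.FeasibleFrom t b p)
    (hb : b ∈ Set.Icc 0 I.B)
    (hc : ∀ n ∈ (nodes p).tail.dropLast, I.kind n ≠ NodeKind.charger) :
    arcSum I.energy (nodes p) ≤ I.B := by
  match p, hf, hc with
  | [], _, _ => simpa [nodes] using I.B_pos.le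
  | [x], _, _ => simpa [nodes] using I.B_pos.le
  | x :: y :: p, hf, hc =>
    rw [feasibleFrom_cons_cons] at hf
    have := energy_le hf.2.2 hf.2.1.1 (by simpa [nodes] using hc)
    simp only [nodes, List.map_cons, arcSum_cons_cons, nextCharge] at this ⊢
    have h1 := min_le_right (b + x.2) I.B
    have h2 := hb.2
    split_ifs at this <;> linarith

/-- Without charging, time only grows and charge only falls, so the bounds on the totals imply those
at each stop. The cap at `B` is inactive because the charge starts at or below `B`. -/
lemma feasibleFrom_zero_charge : ∀ {t b : ℝ} {s : List V}, s.IsChain I.arc → 0 ≤ t →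
    b ≤ I.B → t + arcSum I.time s ≤ I.T → arcSum I.energy s ≤ b →
    I.FeasibleFrom t b (s.map fun v => (v, 0))
  | _, _, [], _, _, _, _, _ => trivial
  | _, _, [_], _, _, _, _, _ => trivial
  | t, b, u :: v :: s, hc, ht, hb, hT, hB => by
    rw [List.isChain_cons_cons] at hc
    rw [arcSum_cons_cons] at hT hB
    have h1 := I.time_pos _ _ hc.1
    have h2 := I.energy_pos _ _ hc.1
    have h3 := arcSum_nonneg (fun i j h => (I.time_pos i j h).le) _ hc.2
    have h4 := arcSum_nonneg (fun i j h => (I.energy_pos i j h).le) _ hc.2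
    have e1 : I.nextTime t (u, 0) v = t + I.time u v := by simp [nextTime]
    have e2 : I.nextCharge b (u, 0) v = b - I.energy u v := by simp [nextCharge, hb]
    simp only [List.map_cons]
    rw [feasibleFrom_cons_cons]
    simp only [e1, e2]
    exact ⟨⟨by linarith, by linarith⟩, ⟨by linarith, by linarith⟩,
      feasibleFrom_zero_charge (s := v :: s) hc.2 (by linarith) (by linarith) (by linarith)
        (by linarith)⟩

/-- Along a feasible partial path, charging times at intermediate stations are at most `T`. -/
lemma FeasibleFrom.charge_le {t b : ℝ} {q r : Path V} {x y : V × ℝ}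
    (h : I.FeasibleFrom t b (q ++ x :: y :: r)) (ht : 0 ≤ t) (hb : b ∈ Set.Icc 0 I.B)
    (hx : I.kind x.1 = NodeKind.charger) (hxy : I.arc x.1 y.1) : x.2 ≤ I.T := by
  obtain ⟨t', b', ht', -, h⟩ := h.suffix ht hb
  have h := (feasibleFrom_cons_cons.1 h).1.2
  have := I.time_pos _ _ hxy
  simp only [nextTime, hx, if_true] at h
  linarith

/-! ### Finiteness -/

lemma time_le_of_mem_partialPaths {p : Path V} (hp : p ∈ I.partialPaths R) :
    arcSum I.time (nodes p) ≤ I.T := by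
  simpa using hp.2.1.time_le I.T_pos.le hp.1.charge_nonneg

section Finiteness

variable [Finite V]

lemma exists_chain_length_bound (I : Instance V) :
    ∃ N : ℕ, ∀ l : List V, l.IsChain I.arc → arcSum I.time l ≤ I.T → l.length ≤ N :=
  exists_length_bound I.time_pos I.T

lemma finite_timely_chains (I : Instance V) :
    {l : List V | l.IsChain I.arc ∧ arcSum I.time l ≤ I.T}.Finite := by
  obtain ⟨N, hN⟩ := I.exists_chain_length_bound
  exact (List.finite_length_le V N).subset fun l hl => hN l hl.1 hl.2

lemma finite_partialSubpaths (I : Instance V) (R : SequenceRule V) :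
    (I.partialSubpaths R).Finite :=
  I.finite_timely_chains.subset fun _ hs => ⟨hs.1.chain, hs.2.1.2⟩

lemma finite_subpaths (I : Instance V) (R : SequenceRule V) : (I.subpaths R).Finite :=
  (I.finite_partialSubpaths R).subset fun _ hs => hs.1

lemma finite_nodes_image (I : Instance V) (R : SequenceRule V) :
    (nodes '' I.partialPaths R).Finite :=
  I.finite_timely_chains.subset (by
    rintro _ ⟨p, hp, rfl⟩
    exact ⟨hp.1.chain, time_le_of_mem_partialPaths hp⟩)

/-- A feasible sequence is realized by a partial path, whose number of nodes is bounded by the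
horizon, and each subpath contributes at least one node of its own. -/
lemma finite_subpathSeqs (I : Instance V) (R : SequenceRule V) : (I.subpathSeqs R).Finite := by
  obtain ⟨N, hN⟩ := I.exists_chain_length_bound
  refine (finite_lists_of_length_le (I.finite_subpaths R) N).subset ?_
  rintro σ ⟨hσ, p, hp, hpσ⟩
  refine ⟨?_, hσ.mem⟩
  refine (length_le_joinNodes fun s hs => (hσ.mem s hs).2.1).trans ?_
  rw [← hpσ]
  exact hN _ hp.1.chain (time_le_of_mem_partialPaths hp)

end Finiteness

/-! ### Prefixes -/

/-- The cut turns `x` into the last node, where the convention allows no charging; its charging time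
is therefore reset to `0`. -/
lemma mem_partialPaths_truncate {q r : Path V} {x : V × ℝ}
    (hp : q ++ x :: r ∈ I.partialPaths R) : q ++ [(x.1, 0)] ∈ I.partialPaths R := by
  obtain ⟨h, hf, hA⟩ := hp
  have hpre : nodes (q ++ [(x.1, 0)]) <+: nodes (q ++ x :: r) := ⟨nodes r, by simp [nodes]⟩
  refine ⟨⟨h.chain.prefix hpre, ?_, ?_, ?_, ?_⟩, hf.truncate, R.of_infix _ _ hpre.isInfix hA⟩
  · have := h.start
    cases q with
    | nil => simpa [nodes] using this
    | cons a q => simpa [nodes] using this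
  · have := h.interior
    cases q with
    | nil => simp [nodes]
    | cons a q =>
      intro n hn
      refine this n ?_
      simp only [nodes, List.map_append, List.map_cons, List.map_nil, List.cons_append,
        List.tail_cons, List.dropLast_concat] at hn ⊢
      rw [List.dropLast_append_of_ne_nil (by simp)]
      exact List.mem_append_left _ hn
  · intro y hy
    rcases List.mem_append.1 hy with hy | hy
    · exact h.charge_nonneg y (by simp [hy])
    · simp only [List.mem_singleton] at hy
      simp [hy]
  · intro k y hk hy
    have hlen : k < q.length := by
      by_contra hlt
      rw [List.getElem?_append_right (by omega)] at hk
      have := List.mem_of_getElem? hk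
      simp only [List.mem_singleton] at this
      exact hy (by simp [this])
    refine ⟨(h.charge_only k y ?_ hy).1, by simp; omega⟩
    rw [List.getElem?_append_left hlen] at hk ⊢
    exact hk

lemma IsSubpathSeq.joinNodes_ne_nil {σ : List (List V)} (hσ : I.IsSubpathSeq R σ) :
    joinNodes σ ≠ [] :=
  ERSP.joinNodes_ne_nil hσ.ne_nil fun s hs => (hσ.mem s hs).2.1

lemma IsSubpathSeq.of_append {σ : List (List V)} {s : List V}
    (h : I.IsSubpathSeq R (σ ++ [s])) (hσ : σ ≠ []) : I.IsSubpathSeq R σ := by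
  have hne := ERSP.joinNodes_ne_nil hσ fun s hs => (h.mem s (by simp [hs])).2.1
  refine ⟨hσ, fun t ht => h.mem t (by simp [ht]), ?_, h.link.left_of_append⟩
  have := h.start
  rwa [head?_joinNodes_append hne hσ] at this

lemma IsSubpathSeq.link_last {σ : List (List V)} {s : List V}
    (h : I.IsSubpathSeq R (σ ++ [s])) (hσ : σ ≠ []) :
    ∃ r, (joinNodes σ).getLast? = some r ∧ s.head? = some r ∧ I.kind r = NodeKind.charger := by
  rcases List.eq_nil_or_concat σ with rfl | ⟨σ, a, rfl⟩
  · exact absurd rfl hσ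
  · rw [List.concat_eq_append] at h ⊢
    rw [getLast?_joinNodes_append (h.mem a (by simp)).2.1]
    exact (List.isChain_append.1 h.link).2.2 a (by simp) s (by simp)

/-- A partial path that realizes the longer sequence is cut at the node where the last subpath
begins. -/
lemma mem_subpathSeqs_of_append {σ : List (List V)} {s : List V}
    (h : σ ++ [s] ∈ I.subpathSeqs R) (hσ : σ ≠ []) : σ ∈ I.subpathSeqs R := by
  obtain ⟨h, p, hp, hpσ⟩ := h
  have h' := h.of_append hσ
  refine ⟨h', ?_⟩
  rcases List.eq_nil_or_concat (joinNodes σ) with h0 | ⟨l, v, hl⟩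
  · exact absurd h0 h'.joinNodes_ne_nil
  rw [List.concat_eq_append] at hl
  rw [joinNodes_append_singleton hσ, hl, nodes, List.append_assoc, List.map_eq_append_iff] at hpσ
  obtain ⟨q, r, rfl, hq, hr⟩ := hpσ
  rw [List.singleton_append, List.map_eq_cons_iff] at hr
  obtain ⟨x, r, rfl, rfl, -⟩ := hr
  exact ⟨_, mem_partialPaths_truncate hp, by simp [nodes, hl, hq]⟩

lemma mem_partialSubpaths_of_append {s s' : List V} (hs : s ≠ [])
    (h : s ++ s' ∈ I.partialSubpaths R) : s ∈ I.partialSubpaths R := by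
  obtain ⟨h, ht, he, hA⟩ := h
  have hc := h.chain.left_of_append
  refine ⟨⟨hc, ?_, ?_⟩, ⟨arcSum_nonneg (fun i j h => (I.time_pos i j h).le) _ hc, ?_⟩,
    ⟨arcSum_nonneg (fun i j h => (I.energy_pos i j h).le) _ hc, ?_⟩,
    R.of_infix _ _ (List.prefix_append s s').isInfix hA⟩
  · have := h.start
    rwa [List.head?_append_of_ne_nil _ hs] at this
  · intro n hn
    refine h.interior n ?_
    cases s with
    | nil => exact absurd rfl hs
    | cons a s =>
      simp only [List.cons_append, List.tail_cons] at hn ⊢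
      by_cases hs' : s' = []
      · simpa [hs'] using hn
      · rw [List.dropLast_append_of_ne_nil hs']
        exact List.mem_append_left _ (List.dropLast_subset _ hn)
  · exact (arcSum_le_append_left (fun i j h => (I.time_pos i j h).le) h.chain).trans ht.2
  · exact (arcSum_le_append_left (fun i j h => (I.energy_pos i j h).le) h.chain).trans he.2

/-- A subpath from a depot starts with a full battery and its energy use is at most `B`, so the
schedule without charging realizes it. -/
lemma singleton_mem_subpathSeqs {s : List V} (hs : s ∈ I.subpaths R)
    (hd : ∃ n, s.head? = some n ∧ I.kind n = NodeKind.depot) : [s] ∈ I.subpathSeqs R := by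
  have hnodes : nodes (s.map fun v => (v, (0 : ℝ))) = s := by
    simp [nodes, Function.comp_def]
  have h := hs.1
  refine ⟨⟨by simp, by simpa using hs, by simpa using hd, by simp⟩,
    s.map fun v => (v, 0), ⟨⟨?_, ?_, ?_, ?_, ?_⟩, ?_, ?_⟩, by simp [hnodes]⟩
  · rw [hnodes]; exact h.1.chain
  · rw [hnodes]; exact hd
  · rw [hnodes]
    intro n hn
    rw [h.1.interior n hn]
    simp
  · simp
  · intro k x hk hx
    have := List.mem_of_getElem? hk
    simp only [List.mem_map] at this
    obtain ⟨a, -, rfl⟩ := this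
    exact absurd rfl hx
  · exact feasibleFrom_zero_charge h.1.chain le_rfl le_rfl (by simpa using h.2.1.2) h.2.2.1.2
  · rw [hnodes]; exact h.2.2.2

end Instance

namespace Instance

variable {V : Type*} {I : Instance V} {R : SequenceRule V}

/-! ### Existence of minimal paths -/

/-- Feasibility unrolls into finitely many conditions that continuous functions of the charging
times lie in closed intervals. The initial time and charge are allowed to vary with the parameter so
that the induction can pass to the next stop. -/
lemma isClosed_feasibleFrom {X : Type*} [TopologicalSpace X] :
    ∀ (l : List (V × (X → ℝ))) (t b : X → ℝ), Continuous t → Continuous b →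
      (∀ z ∈ l, Continuous z.2) →
      IsClosed {x | I.FeasibleFrom (t x) (b x) (l.map fun z => (z.1, z.2 x))}
  | [], _, _, _, _, _ => by simp [FeasibleFrom]
  | [_], _, _, _, _, _ => by simp [FeasibleFrom]
  | z :: w :: l, t, b, ht, hb, hl => by
    have hz : Continuous z.2 := hl z (by simp)
    have h1 : Continuous fun x => I.nextTime (t x) (z.1, z.2 x) w.1 := by
      unfold nextTime
      dsimp only
      split_ifs <;> fun_prop
    have h2 : Continuous fun x => I.nextCharge (b x) (z.1, z.2 x) w.1 := by
      unfold nextCharge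
      dsimp only
      split_ifs <;> fun_prop
    have ih := isClosed_feasibleFrom (w :: l) _ _ h1 h2 fun y hy => hl y (by simp [hy])
    simp only [List.map_cons, feasibleFrom_cons_cons] at ih ⊢
    exact (isClosed_Icc.preimage h1).inter ((isClosed_Icc.preimage h2).inter ih)

lemma continuous_chargeCost {X : Type*} [TopologicalSpace X] (l : List (V × (X → ℝ)))
    (hl : ∀ z ∈ l, Continuous z.2) :
    Continuous fun x => I.chargeCost (l.map fun z => (z.1, z.2 x)) := by
  induction l with
  | nil => simpa [chargeCost] using continuous_const
  | cons z l ih =>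
    have hz : Continuous z.2 := hl z (by simp)
    have ih := ih fun y hy => hl y (by simp [hy])
    simp only [chargeCost, List.map_cons, List.sum_cons] at ih ⊢
    refine Continuous.add ?_ ih
    split_ifs <;> fun_prop

/-- The path with given nodes and charging times. -/
def schedule (l : List V) (τ : Fin l.length → ℝ) : Path V := List.ofFn fun i => (l.get i, τ i)

lemma nodes_schedule (l : List V) (τ : Fin l.length → ℝ) : nodes (schedule l τ) = l := by
  simp [nodes, schedule, List.map_ofFn, Function.comp_def]

lemma exists_schedule (p : Path V) : ∃ τ, p = schedule (nodes p) τ := by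
  refine ⟨fun i => (p.get (i.cast (by simp [nodes]))).2, List.ext_getElem ?_ fun k h1 h2 => ?_⟩
  · simp [schedule, nodes]
  · simp [schedule, nodes]
    rfl

lemma schedule_eq_map (l : List V) (τ : Fin l.length → ℝ) :
    schedule l τ = (List.ofFn fun i => (l.get i, fun τ : Fin l.length → ℝ => τ i)).map
      fun z => (z.1, z.2 τ) := by
  simp [schedule, List.map_ofFn, Function.comp_def]

/-- Once the nodes are fixed, what remains are sign conditions and equations on the charging times,
which are closed conditions. -/
lemma isPartialPath_schedule_iff {p : Path V} (hp : I.IsPartialPath p)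
    (τ : Fin (nodes p).length → ℝ) :
    I.IsPartialPath (schedule (nodes p) τ) ↔ (∀ i, 0 ≤ τ i) ∧
      ∀ i, ¬ (I.kind ((nodes p).get i) = NodeKind.charger ∧ i.1 + 1 < (nodes p).length) →
        τ i = 0 := by
  constructor
  · refine fun h => ⟨fun i => ?_, fun i hi => ?_⟩
    · exact h.charge_nonneg ((nodes p).get i, τ i) (List.mem_ofFn.2 ⟨i, rfl⟩)
    · by_contra h0
      have := h.charge_only i ((nodes p).get i, τ i) (by simp [schedule]) h0
      refine hi ⟨this.1, ?_⟩
      simpa [schedule] using this.2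
  · rintro ⟨h0, h1⟩
    refine ⟨?_, ?_, ?_, ?_, ?_⟩
    · rw [nodes_schedule]; exact hp.chain
    · rw [nodes_schedule]; exact hp.start
    · rw [nodes_schedule]; exact hp.interior
    · intro x hx
      simp only [schedule, List.mem_ofFn] at hx
      obtain ⟨i, rfl⟩ := hx
      exact h0 i
    · intro k x hk hx
      rw [schedule, List.getElem?_ofFn] at hk
      split_ifs at hk with hlt
      · simp only [Option.some.injEq] at hk
        subst hk
        have := mt (h1 ⟨k, hlt⟩) hx
        rw [not_not] at this
        exact ⟨this.1, by simpa [schedule] using this.2⟩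

lemma charge_le_of_mem_partialPaths {p : Path V} (hp : p ∈ I.partialPaths R) {k : ℕ}
    {x : V × ℝ} (hk : p[k]? = some x) : x.2 ≤ I.T := by
  by_cases hx : x.2 = 0
  · rw [hx]; exact I.T_pos.le
  · obtain ⟨hch, hlt⟩ := hp.1.charge_only k x hk hx
    obtain ⟨hk', rfl⟩ := List.getElem?_eq_some_iff.1 hk
    have e : p = p.take k ++ p[k] :: p[k + 1] :: p.drop (k + 2) := by
      rw [← List.drop_eq_getElem_cons hlt, ← List.drop_eq_getElem_cons hk', List.take_append_drop]
    have hf := hp.2.1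
    have hc := hp.1.chain
    rw [e] at hf hc
    refine hf.charge_le le_rfl ⟨I.B_pos.le, le_rfl⟩ hch ?_
    simp only [nodes, List.map_append, List.map_cons] at hc
    exact (List.isChain_cons_cons.1 hc.right_of_append).1

/-- The feasible charging times for given nodes are a closed subset of the cube with sides `[0, T]`,
hence compact, and the charging cost is continuous. -/
lemma exists_min_chargeCost {l : List V} (h : {p ∈ I.partialPaths R | nodes p = l}.Nonempty) :
    ∃ p ∈ {p ∈ I.partialPaths R | nodes p = l}, ∀ q ∈ {p ∈ I.partialPaths R | nodes p = l},
      I.chargeCost p ≤ I.chargeCost q := by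
  obtain ⟨p₀, hp₀, rfl⟩ := h
  have hcont : ∀ z ∈ List.ofFn fun i => ((nodes p₀).get i,
      fun τ : Fin (nodes p₀).length → ℝ => τ i), Continuous z.2 := by
    intro z hz
    simp only [List.mem_ofFn] at hz
    obtain ⟨i, rfl⟩ := hz
    exact continuous_apply i
  set K : Set (Fin (nodes p₀).length → ℝ) :=
    {τ | schedule (nodes p₀) τ ∈ I.partialPaths R} with hK
  have hclosed : IsClosed K := by
    have e : K = ((⋂ i, {τ | 0 ≤ τ i}) ∩ ⋂ i, ⋂ (_ : ¬ (I.kind ((nodes p₀).get i) =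
        NodeKind.charger ∧ i.1 + 1 < (nodes p₀).length)), {τ | τ i = 0}) ∩
        {τ | I.FeasibleFrom 0 I.B (schedule (nodes p₀) τ)} := by
      ext τ
      simp only [hK, partialPaths, Set.mem_ofPred_eq, isPartialPath_schedule_iff hp₀.1,
        nodes_schedule, hp₀.2.2, and_true, Set.mem_inter_iff, Set.mem_iInter]
    rw [e]
    refine (IsClosed.inter ?_ ?_).inter ?_
    · exact isClosed_iInter fun i => isClosed_le continuous_const (continuous_apply i)
    · exact isClosed_iInter fun i => isClosed_iInter fun _ =>
        isClosed_eq (continuous_apply i) continuous_const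
    · simp only [schedule_eq_map]
      exact isClosed_feasibleFrom _ (fun _ => 0) (fun _ => I.B) continuous_const continuous_const
        hcont
  have hcompact : IsCompact K := by
    refine (isCompact_Icc (a := fun _ => (0 : ℝ)) (b := fun _ => I.T)).of_isClosed_subset
      hclosed fun τ hτ => ⟨fun i => ?_, fun i => ?_⟩
    · exact ((isPartialPath_schedule_iff hp₀.1 τ).1 hτ.1).1 i
    · exact charge_le_of_mem_partialPaths hτ (k := i) (x := ((nodes p₀).get i, τ i))
        (by simp [schedule])
  obtain ⟨τ₀, hτ₀⟩ := exists_schedule p₀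
  obtain ⟨τ, hτ, hmin⟩ := hcompact.exists_isMinOn (f := fun τ =>
    I.chargeCost (schedule (nodes p₀) τ)) ⟨τ₀, by rw [hK, Set.mem_ofPred_eq, ← hτ₀]; exact hp₀⟩ (by
      simp only [schedule_eq_map]
      exact (continuous_chargeCost _ hcont).continuousOn)
  refine ⟨_, ⟨hτ, nodes_schedule _ _⟩, ?_⟩
  rintro q ⟨hq, hql⟩
  obtain ⟨τ', hτ'⟩ := exists_schedule q
  rw [hτ'] at hq ⊢
  generalize nodes q = l at *
  subst hql
  exact hmin hq

/-- The subpath contributions are common to all partial paths of `σ`, so only the charging cost is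
left to minimize. -/
lemma exists_isMinimalPath [Fintype V] [DecidableEq V] {σ : List (List V)}
    (hσ : σ ∈ I.subpathSeqs R) (d : Duals V) : ∃ p, I.IsMinimalPath R d σ p := by
  obtain ⟨p, hp, hmin⟩ := exists_min_chargeCost hσ.2
  exact ⟨p, hp, fun q hq => add_le_add_right (hmin q hq) _⟩

end Instance

namespace Instance

variable {V : Type*} {I : Instance V} {R : SequenceRule V}

/-! ### Decomposition of paths into subpaths -/

/-- Recursion on the first arc: if its head is a task, the first node is put in front of the first
subpath of the rest; if its head is a station, the arc is a subpath of its own. Depots are excluded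
in the interior. -/
lemma exists_split (I : Instance V) : ∀ l : List V, 2 ≤ l.length →
    (∀ n ∈ l.tail.dropLast, I.kind n ≠ NodeKind.depot) →
    (∃ n, l.getLast? = some n ∧ I.kind n ≠ NodeKind.task) →
    ∃ σ : List (List V), σ ≠ [] ∧ joinNodes σ = l ∧
      (∀ s ∈ σ, s <:+: l ∧ I.EndsSubpath s ∧ ∀ n ∈ s.tail.dropLast, I.kind n = NodeKind.task) ∧
      (∀ s ∈ σ.tail, ∃ n, s.head? = some n ∧ I.kind n = NodeKind.charger) ∧
      σ.IsChain fun s s' =>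
        ∃ r, s.getLast? = some r ∧ s'.head? = some r ∧ I.kind r = NodeKind.charger
  | [], h, _, _ => by simp at h
  | [_], h, _, _ => by simp at h
  | [u, v], _, _, hlast => ⟨[[u, v]], by simp, by simp,
      by simpa [EndsSubpath] using hlast, by simp, by simp⟩
  | u :: v :: w :: l, _, hint, hlast => by
    have hv : I.kind v ≠ NodeKind.depot := hint v (by simp)
    obtain ⟨σ, hne, hjoin, hmem, htail, hlink⟩ := exists_split I (v :: w :: l) (by simp)
      (fun n hn => hint n (by
        simp only [List.tail_cons, List.dropLast_cons_cons] at hn ⊢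
        exact List.mem_cons_of_mem _ hn))
      (by simpa using hlast)
    obtain ⟨s, σ, rfl⟩ := List.exists_cons_of_ne_nil hne
    have hs := hmem s (by simp)
    obtain ⟨a, b, s, rfl⟩ : ∃ a b s', s = a :: b :: s' := by
      match s, hs.2.1.1 with
      | a :: b :: s', _ => exact ⟨a, b, s', rfl⟩
    have hjoin' := hjoin
    rw [joinNodes_cons] at hjoin
    simp only [List.cons_append, List.cons.injEq] at hjoin
    obtain ⟨rfl, hjoin⟩ := hjoin
    rcases hk : I.kind a with _ | _ | _
    · exact absurd hk hv
    · refine ⟨(u :: a :: b :: s) :: σ, by simp, ?_, ?_, htail, ?_⟩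
      · rw [joinNodes_cons_cons, hjoin']
      · intro t ht
        rcases List.mem_cons.1 ht with rfl | ht
        · refine ⟨List.IsPrefix.isInfix ⟨(σ.map List.tail).flatten, by simp [← hjoin.1, ← hjoin.2]⟩,
            ⟨by simp, by simpa using hs.2.1.2⟩, ?_⟩
          intro n hn
          simp only [List.tail_cons, List.dropLast_cons_cons, List.mem_cons] at hn
          rcases hn with rfl | hn
          · exact hk
          · exact hs.2.2 n (by simpa using hn)
        · have := hmem t (by simp [ht])
          exact ⟨List.infix_cons this.1, this.2⟩
      · cases σ with
        | nil => simp
        | cons t σ =>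
          rw [List.isChain_cons_cons] at hlink ⊢
          exact ⟨by simpa using hlink.1, hlink.2⟩
    · refine ⟨[u, a] :: (a :: b :: s) :: σ, by simp, ?_, ?_, ?_, ?_⟩
      · simp [joinNodes_cons, ← hjoin.1, ← hjoin.2]
      · intro t ht
        rcases List.mem_cons.1 ht with rfl | ht
        · refine ⟨List.IsPrefix.isInfix ⟨w :: l, by simp⟩, ⟨by simp, a, by simp, by simp [hk]⟩,
            by simp⟩
        · have := hmem t ht
          exact ⟨List.infix_cons this.1, this.2⟩
      · intro t ht
        rcases List.mem_cons.1 ht with rfl | ht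
        · exact ⟨a, by simp, hk⟩
        · exact htail t ht
      · rw [List.isChain_cons_cons]
        exact ⟨⟨a, by simp, by simp, hk⟩, hlink⟩

/-- Strictly inside such a stretch no station is visited, so its energy must come from the charge on
leaving its first node, which is at most `B`. -/
lemma arcSum_energy_le_of_infix {p : Path V} (hp : p ∈ I.partialPaths R) {s : List V}
    (hs : s <:+: nodes p) (hint : ∀ n ∈ s.tail.dropLast, I.kind n = NodeKind.task) :
    arcSum I.energy s ≤ I.B := by
  obtain ⟨a, b, hab⟩ := hs
  rw [nodes, eq_comm, List.append_assoc, List.map_eq_append_iff] at hab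
  obtain ⟨q, r, rfl, -, hr⟩ := hab
  rw [List.map_eq_append_iff] at hr
  obtain ⟨r, r', rfl, rfl, -⟩ := hr
  obtain ⟨t, e, -, he, hf⟩ := hp.2.1.suffix le_rfl ⟨I.B_pos.le, le_rfl⟩
  have hf' : I.FeasibleFrom t e r := by
    rcases List.eq_nil_or_concat r with rfl | ⟨r, ⟨v, τ⟩, rfl⟩
    · trivial
    · rw [List.concat_eq_append, List.append_assoc] at hf
      rw [List.concat_eq_append]
      exact hf.truncate
  exact hf'.energy_le_capacity he fun n hn => by rw [hint n hn]; simp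

/-- Every path has a subpath sequence. -/
lemma exists_subpathSeq {p : Path V} (hp : p ∈ I.paths R) :
    ∃ σ ∈ I.subpathSeqs R, I.IsComplete σ ∧ p ∈ I.partialPathsOf R σ := by
  obtain ⟨hp, hlen, hlast⟩ := hp
  obtain ⟨σ, hne, hjoin, hmem, htail, hlink⟩ := exists_split I (nodes p) (by simpa [nodes] using hlen)
    hp.1.interior (by
      obtain ⟨n, hn, hk⟩ := hlast
      exact ⟨n, hn, by simp [hk]⟩)
  have hpσ : p ∈ I.partialPathsOf R σ := ⟨hp, hjoin.symm⟩
  refine ⟨σ, ⟨⟨hne, ?_, by rw [hjoin]; exact hp.1.start, hlink⟩, p, hpσ⟩,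
    by rw [IsComplete, hjoin]; exact hlast, hpσ⟩
  intro s hs
  obtain ⟨hinf, hends, hint⟩ := hmem s hs
  have hc : s.IsChain I.arc := hp.1.chain.infix hinf
  have hT : arcSum I.time (nodes p) ≤ I.T := by
    simpa using hp.2.1.time_le I.T_pos.le hp.1.charge_nonneg
  refine ⟨⟨⟨hc, ?_, hint⟩, ⟨arcSum_nonneg (fun i j h => (I.time_pos i j h).le) _ hc,
    (arcSum_le_of_infix (fun i j h => (I.time_pos i j h).le) hinf hp.1.chain).trans hT⟩,
    ⟨arcSum_nonneg (fun i j h => (I.energy_pos i j h).le) _ hc,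
      arcSum_energy_le_of_infix hp hinf hint⟩, R.of_infix _ _ hinf hp.2.2⟩, hends⟩
  obtain ⟨s₀, σ, rfl⟩ := List.exists_cons_of_ne_nil hne
  rcases List.mem_cons.1 hs with rfl | hs
  · obtain ⟨n, hn, hk⟩ := hp.1.start
    rw [← hjoin, head?_joinNodes_cons (by rintro rfl; simp [EndsSubpath] at hends)] at hn
    exact ⟨n, hn, by simp [hk]⟩
  · obtain ⟨n, hn, hk⟩ := htail s hs
    exact ⟨n, hn, by simp [hk]⟩

/-! ### Reduced costs -/

variable [Fintype V] [DecidableEq V]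

lemma sum_depots_eq_zero {r : V} (hr : I.kind r ≠ NodeKind.depot) (f : V → ℝ) :
    (∑ j ∈ I.depots, if some r = some j then f j else 0) = 0 := by
  refine Finset.sum_eq_zero fun j hj => ?_
  rw [if_neg]
  simp only [Option.some.injEq]
  rintro rfl
  exact hr (by simpa [depots] using hj)

/-- Arc terms add up along the joined nodes. The terms in `κ` and `μ` vanish where subpaths meet,
since these nodes are stations, and only those at the two ends survive. -/
lemma sum_subpathRC (d : Duals V) (σ : List (List V)) (hne : σ ≠ [])
    (hlen : ∀ s ∈ σ, 2 ≤ s.length)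
    (hlink : σ.IsChain fun s s' =>
      ∃ r, s.getLast? = some r ∧ s'.head? = some r ∧ I.kind r = NodeKind.charger) :
    (σ.map (I.subpathRC d)).sum = I.subpathRC d (joinNodes σ) := by
  induction σ using List.reverseRecOn with
  | nil => exact absurd rfl hne
  | append_singleton σ s ih =>
    by_cases hσ : σ = []
    · subst hσ; simp
    have hlen' : ∀ t ∈ σ, 2 ≤ t.length := fun t ht => hlen t (by simp [ht])
    have hs := hlen s (by simp)
    have hj := ERSP.joinNodes_ne_nil hσ hlen'
    obtain ⟨r, hr, hsr, hk⟩ : ∃ r, (joinNodes σ).getLast? = some r ∧ s.head? = some r ∧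
        I.kind r = NodeKind.charger := by
      rcases List.eq_nil_or_concat σ with rfl | ⟨σ, a, rfl⟩
      · exact absurd rfl hσ
      · rw [List.concat_eq_append] at hlink hlen' ⊢
        rw [getLast?_joinNodes_append (hlen' a (by simp))]
        exact (List.isChain_append.1 hlink).2.2 a (by simp) s (by simp)
    rw [List.map_append, List.sum_append, ih hσ hlen' hlink.left_of_append]
    simp only [List.map_cons, List.map_nil, List.sum_cons, List.sum_nil, add_zero, subpathRC,
      head?_joinNodes_append hj hσ, getLast?_joinNodes_append hs, hr, hsr]
    rw [sum_depots_eq_zero (by simp [hk]), sum_depots_eq_zero (by simp [hk]),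
      joinNodes_append_singleton hσ]
    rcases List.eq_nil_or_concat (joinNodes σ) with h0 | ⟨l, v, hl⟩
    · exact absurd h0 hj
    rw [hl] at hr ⊢
    simp only [List.concat_eq_append, List.getLast?_append, List.getLast?_singleton,
      Option.some_or, Option.some.injEq] at hr
    subst hr
    obtain ⟨s, rfl⟩ : ∃ s', s = v :: s' := by
      cases s with
      | nil => simp at hs
      | cons a s =>
        simp only [List.head?_cons, Option.some.injEq] at hsr
        exact ⟨s, by rw [hsr]⟩
    simp only [List.concat_eq_append, List.append_assoc, List.tail_cons, List.singleton_append]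
    rw [arcSum_append_cons _ v s l]
    ring

lemma sum_count_cons (ν : V → ℝ) (v : V) (l : List V) :
    ∑ i ∈ I.tasks, ((v :: l).count i : ℝ) * ν i =
      (if I.kind v = NodeKind.task then ν v else 0) + ∑ i ∈ I.tasks, (l.count i : ℝ) * ν i := by
  have : ∀ i, ((v :: l).count i : ℝ) * ν i =
      (if i = v then ν v else 0) + (l.count i : ℝ) * ν i := by
    intro i
    rw [List.count_cons]
    by_cases h : i = v
    · subst h; simp; ring
    · have : ¬ v = i := fun h' => h h'.symm
      simp [h, this]
  simp only [this, Finset.sum_add_distrib, Finset.sum_ite_eq', tasks, Finset.mem_filter,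
    Finset.mem_univ, true_and]

lemma arcSum_reduced (ν : V → ℝ) : ∀ l : List V,
    arcSum (fun u v => I.cost u v - if I.kind v = NodeKind.task then ν v else 0) l =
      arcSum I.cost l - ∑ i ∈ I.tasks, (l.tail.count i : ℝ) * ν i
  | [] => by simp
  | [_] => by simp
  | u :: v :: l => by
    rw [arcSum_cons_cons, arcSum_cons_cons, arcSum_reduced ν (v :: l), List.tail_cons,
      List.tail_cons, sum_count_cons]
    ring

/-- Contributions subtract `ν` at the head of each arc and so skip the first node. This loses
nothing, because the first node is a depot. -/
lemma pathRC_eq_reducedCost (d : Duals V) {σ : List (List V)} (hσ : I.IsSubpathSeq R σ)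
    {p : Path V} (hp : p ∈ I.partialPathsOf R σ) : I.pathRC d σ p = I.reducedCost d p := by
  rw [pathRC, sum_subpathRC d σ hσ.ne_nil (fun s hs => (hσ.mem s hs).2.1) hσ.link, ← hp.2,
    subpathRC, arcSum_reduced, reducedCost, pathCost]
  obtain ⟨n, hn, hk⟩ := hp.1.1.start
  have : ∑ i ∈ I.tasks, ((nodes p).count i : ℝ) * d.ν i =
      ∑ i ∈ I.tasks, ((nodes p).tail.count i : ℝ) * d.ν i := by
    generalize nodes p = l at *
    cases l with
    | nil => simp at hn
    | cons a l =>
      simp only [List.head?_cons, Option.some.injEq] at hn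
      subst hn
      rw [sum_count_cons]
      simp [hk]
  rw [this]
  ring

end Instance

/-! ### Linear programming duality -/

/-- **Farkas' lemma**: a linear functional that is nonnegative wherever finitely many functionals
are nonnegative is a nonnegative combination of them. -/
theorem farkas {W ι : Type*} [AddCommGroup W] [Module ℝ W] [DecidableEq ι] (s : Finset ι)
    (f : ι → W →ₗ[ℝ] ℝ) (g : W →ₗ[ℝ] ℝ) (h : ∀ x, (∀ i ∈ s, 0 ≤ f i x) → 0 ≤ g x) :
    ∃ c : ι → ℝ, (∀ i, 0 ≤ c i) ∧ ∀ x, g x = ∑ i ∈ s, c i * f i x := by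
  induction s using Finset.induction_on generalizing f g with
  | empty =>
    refine ⟨0, fun _ => le_rfl, fun x => ?_⟩
    have h1 := h x (by simp)
    have h2 := h (-x) (by simp)
    rw [map_neg] at h2
    simp only [Finset.sum_empty]
    linarith
  | insert a s ha ih =>
    by_cases hs : ∀ x, (∀ i ∈ s, 0 ≤ f i x) → 0 ≤ g x
    · obtain ⟨c, hc, hg⟩ := ih f g hs
      refine ⟨Function.update c a 0, fun i => ?_, fun x => ?_⟩
      · by_cases hi : i = a
        · subst hi; simp
        · simpa [hi] using hc i
      · rw [Finset.sum_insert ha, hg]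
        simp only [Function.update_self, zero_mul, zero_add]
        refine Finset.sum_congr rfl fun i hi => ?_
        rw [Function.update_of_ne (by rintro rfl; exact ha hi)]
    · push Not at hs
      obtain ⟨x₀, hx₀, hgx₀⟩ := hs
      have hax₀ : f a x₀ < 0 := by
        by_contra hcon
        refine absurd (h x₀ fun i hi => ?_) (not_le.2 hgx₀)
        rcases Finset.mem_insert.1 hi with rfl | hi
        · exact not_lt.1 hcon
        · exact hx₀ i hi
      -- Scaled so that `f a y = -1`, which makes `x ↦ x + f a x • y` a projection onto the kernel
      -- of `f a`.
      set y : W := (-(f a x₀)⁻¹) • x₀ with hy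
      have hypos : 0 < -(f a x₀)⁻¹ := by simpa using hax₀
      have hay : f a y = -1 := by
        rw [hy, map_smul, smul_eq_mul, neg_mul, inv_mul_cancel₀ hax₀.ne]
      have hfy : ∀ i ∈ s, 0 ≤ f i y := fun i hi => by
        rw [hy, map_smul, smul_eq_mul]; exact mul_nonneg hypos.le (hx₀ i hi)
      have hgy : g y ≤ 0 := by
        rw [hy, map_smul, smul_eq_mul]; exact mul_nonpos_of_nonneg_of_nonpos hypos.le hgx₀.le
      -- The induction hypothesis is applied to the functionals composed with this projection, for
      -- which the constraint `a` holds automatically.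
      obtain ⟨c, hc, hg⟩ := ih (fun i => f i + f i y • f a) (g + g y • f a) (by
        intro x hx
        have := h (x + f a x • y) (by
          intro i hi
          rcases Finset.mem_insert.1 hi with rfl | hi
          · simp [hay]
          · have := hx i hi
            simp only [LinearMap.add_apply, LinearMap.smul_apply, smul_eq_mul, map_add,
              map_smul] at this ⊢
            linarith)
        simp only [LinearMap.add_apply, LinearMap.smul_apply, smul_eq_mul, map_add,
          map_smul] at this ⊢
        linarith)
      have hpos : 0 ≤ (∑ i ∈ s, c i * f i y) - g y :=
        sub_nonneg.2 (hgy.trans (Finset.sum_nonneg fun i hi => mul_nonneg (hc i) (hfy i hi)))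
      -- The multiplier of `f a` is found by collecting its coefficients after the projection is
      -- expanded.
      refine ⟨Function.update c a ((∑ i ∈ s, c i * f i y) - g y), fun i => ?_, fun x => ?_⟩
      · by_cases hi : i = a
        · subst hi; simpa using hpos
        · simpa [hi] using hc i
      · have hx := hg x
        simp only [LinearMap.add_apply, LinearMap.smul_apply, smul_eq_mul, mul_add,
          Finset.sum_add_distrib] at hx
        rw [Finset.sum_insert ha, Function.update_self]
        have e : ∑ i ∈ s, Function.update c a ((∑ i ∈ s, c i * f i y) - g y) i * f i x =
            ∑ i ∈ s, c i * f i x := by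
          refine Finset.sum_congr rfl fun i hi => ?_
          rw [Function.update_of_ne (by rintro rfl; exact ha hi)]
        rw [e, sub_mul, Finset.sum_mul]
        simp only [mul_assoc]
        linarith

/-- **Strong duality**, existence of dual solutions: if every solution `z ≥ 0`, `s ≥ 0` of
`∑ z p • a p - ∑ s j • e j = b` has cost at least `v`, where the costs are nonnegative, then some
`x` with `e j x ≥ 0` and `a p x ≤ c p` satisfies `v ≤ b x`. -/
theorem exists_dual_solution {W ι κ : Type*} [AddCommGroup W] [Module ℝ W] [DecidableEq ι]
    [DecidableEq κ] (P : Finset ι) (J : Finset κ) (a : ι → W →ₗ[ℝ] ℝ) (c : ι → ℝ)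
    (hc : ∀ p ∈ P, 0 ≤ c p) (e : κ → W →ₗ[ℝ] ℝ) (b : W →ₗ[ℝ] ℝ) (v : ℝ)
    (hv : ∀ (z : ι → ℝ) (s : κ → ℝ), (∀ p, 0 ≤ z p) → (∀ j, 0 ≤ s j) →
      (∀ x, ∑ p ∈ P, z p * a p x - ∑ j ∈ J, s j * e j x = b x) → v ≤ ∑ p ∈ P, z p * c p) :
    ∃ x, (∀ j ∈ J, 0 ≤ e j x) ∧ (∀ p ∈ P, a p x ≤ c p) ∧ v ≤ b x := by
  by_contra hcon
  push Not at hcon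
  -- The system is homogenized by a scale variable `t ≥ 0`. If it has no solution, the homogeneous
  -- inequalities leave no room for `t > 0`, that is, they imply `-t ≥ 0`, and Farkas' lemma
  -- provides multipliers.
  let t : W × ℝ →ₗ[ℝ] ℝ := LinearMap.snd ℝ W ℝ
  let d : W × ℝ →ₗ[ℝ] W := LinearMap.fst ℝ W ℝ
  let f : (ι ⊕ κ) ⊕ Bool → W × ℝ →ₗ[ℝ] ℝ := Sum.elim
    (Sum.elim (fun p => c p • t - (a p).comp d) fun j => (e j).comp d)
    fun i => if i then b.comp d - v • t else t
  obtain ⟨w, hw, heq⟩ := farkas ((P.disjSum J).disjSum Finset.univ) f (-t) (by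
    rintro ⟨x, r⟩ hx
    have hr : 0 ≤ r := by
      simpa [f, t] using hx (Sum.inr false) (by simp)
    have hbx : v * r ≤ b x := by
      simpa [f, t, d] using hx (Sum.inr true) (by simp)
    have hax : ∀ p ∈ P, a p x ≤ c p * r := fun p hp => by
      simpa [f, t, d] using hx (Sum.inl (Sum.inl p)) (by simpa using hp)
    have hex : ∀ j ∈ J, 0 ≤ e j x := fun j hj => by
      simpa [f, t, d] using hx (Sum.inl (Sum.inr j)) (by simpa using hj)
    rcases hr.eq_or_lt with rfl | hr
    · simp [t]
    · exfalso
      have hr' : 0 ≤ r⁻¹ := by positivity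
      refine absurd (hcon (r⁻¹ • x) (fun j hj => ?_) (fun p hp => ?_)) (not_lt.2 ?_)
      · rw [map_smul, smul_eq_mul]
        exact mul_nonneg hr' (hex j hj)
      · rw [map_smul, smul_eq_mul, inv_mul_le_iff₀ hr, mul_comm]
        exact hax p hp
      · rw [map_smul, smul_eq_mul, le_inv_mul_iff₀ hr, mul_comm]
        exact hbx)
  have h0 : ∀ x, ∑ p ∈ P, w (Sum.inl (Sum.inl p)) * a p x -
      ∑ j ∈ J, w (Sum.inl (Sum.inr j)) * e j x = w (Sum.inr true) * b x := by
    intro x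
    have := heq (x, 0)
    simp [Finset.sum_disjSum, f, t, d] at this
    linarith
  have h1 : ∑ p ∈ P, w (Sum.inl (Sum.inl p)) * c p + w (Sum.inr false) + 1 =
      w (Sum.inr true) * v := by
    have := heq (0, 1)
    simp [Finset.sum_disjSum, f, t, d] at this
    linarith
  have hnn : 0 ≤ ∑ p ∈ P, w (Sum.inl (Sum.inl p)) * c p :=
    Finset.sum_nonneg fun p hp => mul_nonneg (hw _) (hc p hp)
  have hf := hw (Sum.inr false)
  -- If the multiplier of the objective row is zero, `h1` equates a positive number with `0`; here
  -- the nonnegativity of the costs enters. Otherwise division by this multiplier gives a primal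
  -- solution of cost below `v`.
  rcases (hw (Sum.inr true)).eq_or_lt with hl | hl
  · rw [← hl, zero_mul] at h1
    linarith
  · set l := w (Sum.inr true) with hldef
    have hl' : 0 ≤ l⁻¹ := by positivity
    have := hv (fun p => l⁻¹ * w (Sum.inl (Sum.inl p))) (fun j => l⁻¹ * w (Sum.inl (Sum.inr j)))
      (fun p => mul_nonneg hl' (hw _)) (fun j => mul_nonneg hl' (hw _)) (fun x => by
        simp only [mul_assoc]
        rw [← Finset.mul_sum, ← Finset.mul_sum, ← mul_sub, h0, inv_mul_cancel_left₀ hl.ne'])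
    simp only [mul_assoc] at this
    rw [← Finset.mul_sum, le_inv_mul_iff₀ hl] at this
    linarith

lemma sum_ite_eq_some_single {V : Type*} [DecidableEq V] {J : Finset V} {j : V} (hj : j ∈ J)
    (o : Option V) :
    (∑ i ∈ J, if o = some i then (Pi.single j 1 : V → ℝ) i else 0) =
      if o = some j then 1 else 0 := by
  rw [Finset.sum_eq_single_of_mem j hj fun i _ hij => by simp [hij]]
  simp

namespace Instance

variable {V : Type*} {I : Instance V} {R : SequenceRule V}

/-! ### The master problem and its dual -/

/-- The first arc already has a positive cost. Strictness is what bounds each weight once the master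
objective is bounded. -/
lemma pathCost_pos {p : Path V} (hp : p ∈ I.paths R) : 0 < I.pathCost p := by
  obtain ⟨⟨hp, -, -⟩, hlen, -⟩ := hp
  have h1 : 0 < arcSum I.cost (nodes p) := by
    have hc := hp.chain
    have hl : 2 ≤ (nodes p).length := by simpa [nodes] using hlen
    generalize nodes p = l at *
    match l, hl with
    | u :: v :: l, _ =>
      rw [List.isChain_cons_cons] at hc
      rw [arcSum_cons_cons]
      exact add_pos_of_pos_of_nonneg (I.cost_pos _ _ hc.1)
        (arcSum_nonneg (fun i j h => (I.cost_pos i j h).le) _ hc.2)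
  refine add_pos_of_pos_of_nonneg h1 (List.sum_nonneg ?_)
  simp only [List.mem_map]
  rintro _ ⟨x, hx, rfl⟩
  split_ifs with hk
  · exact mul_nonneg (I.chargeRate_pos _ hk).le (hp.charge_nonneg x hx)
  · exact le_rfl

lemma objective_eq_sum {F : Finset (Path V)} {z : Path V →₀ ℝ} (hz : ∀ p, z p ≠ 0 → p ∈ F) :
    I.objective z = ∑ p ∈ F, I.pathCost p * z p :=
  Finsupp.sum_of_support_subset _ (fun p hp => hz p (Finsupp.mem_support_iff.1 hp)) _ (by simp)

/-- A function supported in a finite set is finitely supported. -/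
lemma exists_finsupp_coe_eq {F : Finset (Path V)} {z : Path V → ℝ} (hz : ∀ p, z p ≠ 0 → p ∈ F) :
    ∃ z' : Path V →₀ ℝ, ⇑z' = z :=
  ⟨Finsupp.onFinset F z hz, rfl⟩

variable [Fintype V] [DecidableEq V]

/-- The objective in terms of reduced costs. -/
lemma objective_eq (d : Duals V) (z : Path V →₀ ℝ) :
    I.objective z = (z.sum fun p w => I.reducedCost d p * w) +
      (∑ j ∈ I.depots, d.κ j * z.sum fun p w => if (nodes p).head? = some j then w else 0) +
      (∑ j ∈ I.depots, d.μ j * z.sum fun p w => if (nodes p).getLast? = some j then w else 0) +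
      ∑ i ∈ I.tasks, d.ν i * z.sum fun p w => ((nodes p).count i : ℝ) * w := by
  simp only [objective, Finsupp.sum, Finset.mul_sum]
  rw [Finset.sum_comm (s := I.depots), Finset.sum_comm (s := I.depots),
    Finset.sum_comm (s := I.tasks), ← Finset.sum_add_distrib, ← Finset.sum_add_distrib,
    ← Finset.sum_add_distrib]
  refine Finset.sum_congr rfl fun p _ => ?_
  simp only [reducedCost, sub_mul, Finset.sum_mul, ite_mul, zero_mul, mul_ite, mul_zero]
  have : ∑ i ∈ I.tasks, ((nodes p).count i : ℝ) * d.ν i * z p =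
      ∑ i ∈ I.tasks, d.ν i * (((nodes p).count i : ℝ) * z p) :=
    Finset.sum_congr rfl fun i _ => by ring
  rw [this]
  ring

/-- **Weak duality.** -/
lemma dualObjective_le_objective {Q : Set (Path V)} {z : Path V →₀ ℝ} {d : Duals V}
    (hz : I.IsFeasible Q z) (hd : I.IsDualFeasible Q d) : I.dualObjective d ≤ I.objective z := by
  rw [objective_eq d z, dualObjective]
  have h0 : 0 ≤ z.sum fun p w => I.reducedCost d p * w :=
    Finset.sum_nonneg fun p hp => mul_nonneg
      (hd.2 p (hz.support p (Finsupp.mem_support_iff.1 hp))) (hz.nonneg p)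
  have h1 : (∑ j ∈ I.depots, d.κ j * z.sum fun p w =>
      if (nodes p).head? = some j then w else 0) = ∑ j ∈ I.depots, (I.vStart j : ℝ) * d.κ j :=
    Finset.sum_congr rfl fun j hj => by rw [hz.start_eq j hj, mul_comm]
  have h2 : ∑ j ∈ I.depots, (I.vEnd j : ℝ) * d.μ j ≤ ∑ j ∈ I.depots, d.μ j * z.sum fun p w =>
      if (nodes p).getLast? = some j then w else 0 :=
    Finset.sum_le_sum fun j hj => by
      rw [mul_comm]
      exact mul_le_mul_of_nonneg_left (hz.end_ge j hj) (hd.1 j hj)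
  have h3 : (∑ i ∈ I.tasks, d.ν i * z.sum fun p w => ((nodes p).count i : ℝ) * w) =
      ∑ i ∈ I.tasks, d.ν i :=
    Finset.sum_congr rfl fun i hi => by rw [hz.serve_eq i hi, mul_one]
  linarith

variable (I) in
/-- Feasibility for the relaxation over a finite set of paths, for functions in place of finitely
supported functions. -/
structure IsFeasibleOn (F : Finset (Path V)) (z : Path V → ℝ) : Prop where
  support : ∀ p, z p ≠ 0 → p ∈ F
  nonneg : ∀ p, 0 ≤ z p
  start_eq : ∀ j ∈ I.depots,
    (∑ p ∈ F, if (nodes p).head? = some j then z p else 0) = (I.vStart j : ℝ)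
  end_ge : ∀ j ∈ I.depots,
    (I.vEnd j : ℝ) ≤ ∑ p ∈ F, if (nodes p).getLast? = some j then z p else 0
  serve_eq : ∀ i ∈ I.tasks, (∑ p ∈ F, ((nodes p).count i : ℝ) * z p) = 1

lemma isFeasible_iff {F : Finset (Path V)} {z : Path V →₀ ℝ} :
    I.IsFeasible (F : Set (Path V)) z ↔ I.IsFeasibleOn F z := by
  by_cases hs : z.support ⊆ F
  · have e1 : ∀ j, (z.sum fun p w => if (nodes p).head? = some j then w else 0) =
        ∑ p ∈ F, if (nodes p).head? = some j then z p else 0 := fun j =>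
      Finsupp.sum_of_support_subset _ hs _ (by simp)
    have e2 : ∀ j, (z.sum fun p w => if (nodes p).getLast? = some j then w else 0) =
        ∑ p ∈ F, if (nodes p).getLast? = some j then z p else 0 := fun j =>
      Finsupp.sum_of_support_subset _ hs _ (by simp)
    have e3 : ∀ i, (z.sum fun p w => ((nodes p).count i : ℝ) * w) =
        ∑ p ∈ F, ((nodes p).count i : ℝ) * z p := fun j =>
      Finsupp.sum_of_support_subset _ hs _ (by simp)
    constructor
    · rintro ⟨h1, h2, h3, h4, h5⟩
      simp only [e1, e2, e3] at h3 h4 h5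
      exact ⟨h1, h2, h3, h4, h5⟩
    · rintro ⟨h1, h2, h3, h4, h5⟩
      refine ⟨h1, h2, ?_, ?_, ?_⟩ <;> simpa only [e1, e2, e3]
  · exact ⟨fun h => absurd (fun p hp => h.support p (Finsupp.mem_support_iff.1 hp)) hs,
      fun h => absurd (fun p hp => h.support p (Finsupp.mem_support_iff.1 hp)) hs⟩

/-- The feasible points that are no worse than a given one form a compact set: since path costs are
positive, a bound on the objective bounds each weight. -/
lemma exists_isOptimal {P : Set (Path V)} (hP : P.Finite) (hsub : P ⊆ I.paths R)
    (hfeas : ∃ z, I.IsFeasible P z) : ∃ z, I.IsOptimal P z := by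
  obtain ⟨F, rfl⟩ := hP.exists_finset_coe
  obtain ⟨z₀, hz₀⟩ := hfeas
  have hcont : Continuous fun z : Path V → ℝ => ∑ p ∈ F, I.pathCost p * z p :=
    continuous_finsetSum _ fun p _ => continuous_const.mul (continuous_apply p)
  set M := I.objective z₀ with hM
  set K : Set (Path V → ℝ) :=
    {z | I.IsFeasibleOn F z ∧ ∑ p ∈ F, I.pathCost p * z p ≤ M} with hK
  have hclosed : IsClosed K := by
    have e : K = (⋂ p, {z : Path V → ℝ | z p ≠ 0 → p ∈ F}) ∩ (⋂ p, {z | 0 ≤ z p}) ∩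
        (⋂ j ∈ I.depots, {z | (∑ p ∈ F, if (nodes p).head? = some j then z p else 0) =
          (I.vStart j : ℝ)}) ∩
        (⋂ j ∈ I.depots, {z | (I.vEnd j : ℝ) ≤
          ∑ p ∈ F, if (nodes p).getLast? = some j then z p else 0}) ∩
        (⋂ i ∈ I.tasks, {z | (∑ p ∈ F, ((nodes p).count i : ℝ) * z p) = 1}) ∩
        {z | ∑ p ∈ F, I.pathCost p * z p ≤ M} := by
      ext z
      simp only [hK, Set.mem_ofPred_eq, Set.mem_inter_iff, Set.mem_iInter]
      constructor
      · rintro ⟨⟨h1, h2, h3, h4, h5⟩, h6⟩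
        exact ⟨⟨⟨⟨⟨h1, h2⟩, h3⟩, h4⟩, h5⟩, h6⟩
      · rintro ⟨⟨⟨⟨⟨h1, h2⟩, h3⟩, h4⟩, h5⟩, h6⟩
        exact ⟨⟨h1, h2, h3, h4, h5⟩, h6⟩
    rw [e]
    refine (((((IsClosed.inter ?_ ?_).inter ?_).inter ?_).inter ?_).inter ?_)
    · refine isClosed_iInter fun p => ?_
      by_cases hp : p ∈ F
      · simp [hp]
      · simpa [hp] using isClosed_eq (continuous_apply p) continuous_const
    · exact isClosed_iInter fun p => isClosed_le continuous_const (continuous_apply p)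
    · refine isClosed_biInter fun j _ => isClosed_eq (continuous_finsetSum _ fun p _ => ?_)
        continuous_const
      split_ifs <;> fun_prop
    · refine isClosed_biInter fun j _ => isClosed_le continuous_const
        (continuous_finsetSum _ fun p _ => ?_)
      split_ifs <;> fun_prop
    · exact isClosed_biInter fun i _ => isClosed_eq
        (continuous_finsetSum _ fun p _ => continuous_const.mul (continuous_apply p))
        continuous_const
    · exact isClosed_le hcont continuous_const
  have hcompact : IsCompact K := by
    -- The absolute value keeps the bound nonnegative for paths outside `F`, whose weight is zero.
    refine (isCompact_Icc (a := fun _ : Path V => (0 : ℝ))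
      (b := fun p => |M / I.pathCost p|)).of_isClosed_subset hclosed fun z hz =>
        ⟨fun p => hz.1.nonneg p, fun p => ?_⟩
    by_cases hp : p ∈ F
    · refine le_trans ?_ (le_abs_self _)
      rw [le_div_iff₀ (pathCost_pos (hsub hp)), mul_comm]
      refine le_trans ?_ hz.2
      exact Finset.single_le_sum (f := fun p => I.pathCost p * z p)
        (fun q hq => mul_nonneg (pathCost_pos (hsub hq)).le (hz.1.nonneg q)) hp
    · have : z p = 0 := by
        by_contra h0
        exact hp (hz.1.support p h0)
      simp only [this]
      exact abs_nonneg _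
  have hz₀' := isFeasible_iff.1 hz₀
  obtain ⟨z, hz, hmin⟩ := hcompact.exists_isMinOn
    ⟨z₀, hz₀', (objective_eq_sum hz₀'.support).ge⟩ hcont.continuousOn
  obtain ⟨z, rfl⟩ := exists_finsupp_coe_eq hz.1.support
  refine ⟨z, isFeasible_iff.2 hz.1, fun z' hz' => ?_⟩
  have hz'' := isFeasible_iff.1 hz'
  by_cases hle : I.objective z' ≤ M
  · rw [objective_eq_sum hz.1.support, objective_eq_sum hz''.support]
    exact hmin ⟨hz'', (objective_eq_sum hz''.support).ge.trans hle⟩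
  · rw [objective_eq_sum hz.1.support]
    exact hz.2.trans (not_le.1 hle).le

variable (I) in
/-- The constraint coefficients of a path, as a functional on the dual variables. -/
def coeff (p : Path V) : (V → ℝ) × (V → ℝ) × (V → ℝ) →ₗ[ℝ] ℝ where
  toFun w := (∑ j ∈ I.depots, if (nodes p).head? = some j then w.1 j else 0) +
    (∑ j ∈ I.depots, if (nodes p).getLast? = some j then w.2.1 j else 0) +
    ∑ i ∈ I.tasks, ((nodes p).count i : ℝ) * w.2.2 i
  map_add' w w' := by
    simp only [Prod.fst_add, Prod.snd_add, Pi.add_apply, mul_add, Finset.sum_add_distrib,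
      ← Finset.sum_filter]
    ring
  map_smul' r w := by
    simp only [Prod.smul_fst, Prod.smul_snd, Pi.smul_apply, smul_eq_mul, RingHom.id_apply,
      ← Finset.sum_filter, mul_add, Finset.mul_sum]
    congr 1
    exact Finset.sum_congr rfl fun i _ => by ring

variable (I) in
/-- The objective of the dual as a functional on the dual variables. -/
def dualFunctional : (V → ℝ) × (V → ℝ) × (V → ℝ) →ₗ[ℝ] ℝ where
  toFun w := (∑ j ∈ I.depots, (I.vStart j : ℝ) * w.1 j) +
    (∑ j ∈ I.depots, (I.vEnd j : ℝ) * w.2.1 j) + ∑ i ∈ I.tasks, w.2.2 i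
  map_add' w w' := by
    simp only [Prod.fst_add, Prod.snd_add, Pi.add_apply, mul_add, Finset.sum_add_distrib]
    ring
  map_smul' r w := by
    simp only [Prod.smul_fst, Prod.smul_snd, Pi.smul_apply, smul_eq_mul, RingHom.id_apply,
      mul_add, Finset.mul_sum]
    congr 1
    congr 1 <;> exact Finset.sum_congr rfl fun i _ => by ring

/-- Strong duality is applied with surplus variables for the end constraints only. The vector
identity of the primal system is tested on unit vectors, which recovers the constraints one by one.
-/
lemma exists_isDualFeasible_ge {P : Set (Path V)} (hP : P.Finite) (hsub : P ⊆ I.paths R)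
    {z : Path V →₀ ℝ} (hz : I.IsOptimal P z) :
    ∃ d, I.IsDualFeasible P d ∧ I.objective z ≤ I.dualObjective d := by
  classical
  obtain ⟨F, rfl⟩ := hP.exists_finset_coe
  obtain ⟨⟨κ, μ, ν⟩, hμ, hc, hv⟩ := exists_dual_solution F I.depots I.coeff I.pathCost
    (fun p hp => (pathCost_pos (hsub hp)).le)
    (fun j => (LinearMap.proj j).comp
      ((LinearMap.fst ℝ _ _).comp (LinearMap.snd ℝ (V → ℝ) ((V → ℝ) × (V → ℝ)))))
    I.dualFunctional (I.objective z) (by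
      intro y s hy hs heq
      -- Nothing is known about `y` outside `F`, so it is set to zero there.
      obtain ⟨y', hy'⟩ := exists_finsupp_coe_eq (F := F) (z := fun p => if p ∈ F then y p else 0)
        (fun p hp => by by_contra h; simp [h] at hp)
      have hsupp : ∀ p, y' p ≠ 0 → p ∈ F := fun p hp => by
        by_contra h; simp [hy', h] at hp
      have hobj : I.objective y' = ∑ p ∈ F, y p * I.pathCost p := by
        rw [objective_eq_sum hsupp]
        exact Finset.sum_congr rfl fun p hp => by simp [hy', hp, mul_comm]
      rw [← hobj]
      refine hz.2 y' (isFeasible_iff.2 ⟨hsupp, fun p => ?_, fun j hj => ?_, fun j hj => ?_,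
        fun i hi => ?_⟩)
      · simp only [hy']
        split_ifs
        exacts [hy p, le_rfl]
      · have := heq (Pi.single j 1, 0, 0)
        simp only [coeff, dualFunctional, LinearMap.coe_mk, AddHom.coe_mk,
          sum_ite_eq_some_single hj] at this
        simp only [hy']
        rw [Finset.sum_congr rfl (g := fun p => if (nodes p).head? = some j then y p else 0)
          fun p hp => by simp [hp]]
        simpa [hj, Pi.single_apply] using this
      · have := heq (0, Pi.single j 1, 0)
        simp only [coeff, dualFunctional, LinearMap.coe_mk, AddHom.coe_mk,
          sum_ite_eq_some_single hj] at this
        have hsj := hs j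
        simp [hj, Pi.single_apply, sub_eq_iff_eq_add] at this
        simp only [hy']
        rw [Finset.sum_congr rfl (g := fun p => if (nodes p).getLast? = some j then y p else 0)
          fun p hp => by simp [hp]]
        linarith
      · have := heq (0, 0, Pi.single i 1)
        simp only [coeff, dualFunctional, LinearMap.coe_mk, AddHom.coe_mk] at this
        simp [hi, Pi.single_apply] at this
        rw [← this]
        exact Finset.sum_congr rfl fun p hp => by simp [hy', hp, mul_comm])
  refine ⟨⟨κ, μ, ν⟩, ⟨hμ, fun p hp => ?_⟩, hv⟩
  have := hc p hp
  simp only [coeff, LinearMap.coe_mk, AddHom.coe_mk] at this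
  simp only [reducedCost]
  linarith

lemma exists_isDualOptimal {P : Set (Path V)} (hP : P.Finite) (hsub : P ⊆ I.paths R)
    {z : Path V →₀ ℝ} (hz : I.IsOptimal P z) : ∃ d, I.IsDualOptimal P d := by
  obtain ⟨d, hd, hle⟩ := exists_isDualFeasible_ge hP hsub hz
  exact ⟨d, hd, fun d' hd' => (dualObjective_le_objective hz.1 hd').trans hle⟩

/-- An optimal solution over a finite path set is optimal over all paths if the reduced costs of
all paths with respect to an optimal dual solution are nonnegative. -/
lemma isOptimal_of_reducedCost_nonneg {P Q : Set (Path V)} (hP : P.Finite)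
    (hsub : P ⊆ I.paths R) (hPQ : P ⊆ Q) {z : Path V →₀ ℝ} (hz : I.IsOptimal P z) {d : Duals V}
    (hd : I.IsDualOptimal P d) (hrc : ∀ p ∈ Q, 0 ≤ I.reducedCost d p) : I.IsOptimal Q z := by
  refine ⟨{ hz.1 with support := fun p hp => hPQ (hz.1.support p hp) }, fun z' hz' => ?_⟩
  obtain ⟨d', hd', hle⟩ := exists_isDualFeasible_ge hP hsub hz
  -- By nonnegative reduced costs, `d` is dual feasible over all of `Q`, so weak duality bounds
  -- every competitor from below by its dual objective.
  exact hle.trans ((hd.2 d' hd').trans (dualObjective_le_objective hz' ⟨hd.1.1, hrc⟩))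

end Instance

/-! ### Domination as a preorder -/

lemma Criteria.Dominates.refl {L α ι : Type*} (C : Criteria L α ι) (x : L) : C.Dominates x x :=
  ⟨rfl, fun _ => le_rfl⟩

lemma Criteria.Dominates.trans {L α ι : Type*} {C : Criteria L α ι} {x y z : L}
    (h : C.Dominates x y) (h' : C.Dominates y z) : C.Dominates x z :=
  ⟨h.1.trans h'.1, fun k => (h.2 k).trans (h'.2 k)⟩

namespace LabelData

open Instance

variable {V α ι β ι' : Type*} {A : LabelData V α ι β ι'}
  {I : Instance V} {R : SequenceRule V} {d : Duals V}

/-! ### The two levels of the pricing algorithm -/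

lemma subProc_prunes_trans (x y z : List V) (h : (A.subProc I R d).prunes x y)
    (h' : (A.subProc I R d).prunes y z) : (A.subProc I R d).prunes x z :=
  ⟨h.1, h.2.trans h'.2⟩

lemma subProc_prunes_self (x : List V) :
    ∀ y ∈ (A.subProc I R d).extensions x, (A.subProc I R d).prunes y y := by
  rintro _ ⟨u, v, hu, -, rfl⟩
  refine ⟨?_, Criteria.Dominates.refl _ _⟩
  cases x with
  | nil => simp at hu
  | cons a x => simp

lemma subProc_extensions_finite [Finite V] (x : List V) : ((A.subProc I R d).extensions x).Finite :=
  (Set.finite_range fun v => x ++ [v]).subset (by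
    rintro _ ⟨u, v, -, -, rfl⟩
    exact ⟨v, rfl⟩)

lemma subInit_finite [Finite V] (I : Instance V) : (subInit I).queue.Finite :=
  (Set.finite_range fun v : V => [v]).subset (by
    rintro _ ⟨v, -, rfl⟩
    exact ⟨v, rfl⟩)

lemma mem_partialSubpaths_of_gen {S : LabelState (List V)}
    (hS : (A.subProc I R d).Inv (subInit I).queue S) {s : List V} (hs : s ∈ S.gen)
    (hl : 2 ≤ s.length) : s ∈ I.partialSubpaths R := by
  rcases hS.gen_subset hs with ⟨n, -, rfl⟩ | h
  · simp at hl
  · exact h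

lemma sub_resource_lt {k : ι} (hk : ∀ s ∈ I.partialSubpaths R, ∀ v,
      s ++ [v] ∈ I.partialSubpaths R → (A.sub d).D s k < (A.sub d).D (s ++ [v]) k)
    {s : List V} (hs : s ≠ []) (l : List V) (hl : l ≠ []) (h : s ++ l ∈ I.partialSubpaths R) :
    (A.sub d).D s k < (A.sub d).D (s ++ l) k := by
  induction l using List.reverseRecOn with
  | nil => exact absurd rfl hl
  | append_singleton l v ih =>
    rw [← List.append_assoc] at h ⊢
    have h' := mem_partialSubpaths_of_append (by simp [hs]) h
    by_cases hl' : l = []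
    · subst hl'
      rw [List.append_nil] at h h' ⊢
      exact hk s h' v h
    · exact (ih hl' h').trans (hk _ h' v h)

lemma seqProc_prunes_trans {Sstar : Set (List V)} (x y z : List (List V))
    (h : (A.seqProc I R d Sstar).prunes x y) (h' : (A.seqProc I R d Sstar).prunes y z) :
    (A.seqProc I R d Sstar).prunes x z := Criteria.Dominates.trans h h'

lemma seqProc_extensions_finite {Sstar : Set (List V)} (hfin : Sstar.Finite)
    (x : List (List V)) : ((A.seqProc I R d Sstar).extensions x).Finite :=
  (hfin.image fun s => x ++ [s]).subset (by
    rintro _ ⟨s, hs, -, rfl⟩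
    exact ⟨s, hs, rfl⟩)

lemma seqInit_subset {Sstar : Set (List V)} (hsub : Sstar ⊆ I.subpaths R) :
    (seqInit I Sstar).queue ⊆ I.subpathSeqs R := by
  rintro _ ⟨s, hs, hd, rfl⟩
  exact singleton_mem_subpathSeqs (hsub hs) hd

lemma seq_gen_subset {Sstar : Set (List V)} (hsub : Sstar ⊆ I.subpaths R)
    {S : LabelState (List (List V))}
    (hS : (A.seqProc I R d Sstar).Inv (seqInit I Sstar).queue S) : S.gen ⊆ I.subpathSeqs R :=
  hS.gen_subset.trans (Set.union_subset (seqInit_subset hsub) subset_rfl)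

/-- At the end of the first level, every feasible partial subpath with at least one arc is
dominated by a generated one. -/
lemma exists_gen_dominates [Fintype V] [DecidableEq V] (hE : A.RecordsEndpoints I R d)
    (h1 : A.SubpathDomination I R d) (h3 : A.SubpathTermination I R d) {S : LabelState (List V)}
    (hS : (A.subProc I R d).Inv (subInit I).queue S) (hq : S.queue = ∅) (s : List V)
    (hs : s ∈ I.partialSubpaths R) :
    (s.length = 1 → s ∈ S.gen) ∧
      (2 ≤ s.length → ∃ s' ∈ S.gen, 2 ≤ s'.length ∧ (A.sub d).Dominates s' s) := by
  induction s using List.reverseRecOn with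
  | nil => simp
  | append_singleton s v ih =>
    by_cases hne : s = []
    · subst hne
      refine ⟨fun _ => ?_, by simp⟩
      rw [List.nil_append] at hs ⊢
      obtain ⟨n, hn, hkind⟩ := hs.1.start
      simp only [List.head?_cons, Option.some.injEq] at hn
      subst hn
      rcases hS.init_covered [v] ⟨v, hkind, rfl⟩ with h | ⟨w, hw, hwl, hwd⟩
      · simpa [hq] using h
      · exfalso
        simp only [hq, Set.empty_union] at hw
        have hwf := mem_partialSubpaths_of_gen hS hw hwl
        have hh := (hE.sub w hwf [v] hs hwd.1).1
        obtain ⟨k, M, -, hk⟩ := h3.resource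
        -- A pruner of the seed would start at the same node and have an arc, hence properly extend
        -- the seed. Its increasing resource would then be larger than that of the seed, against
        -- domination.
        match w, hwl with
        | a :: b :: w, _ =>
          simp only [List.head?_cons, Option.some.injEq] at hh
          subst hh
          exact absurd (hwd.2 k) (not_le.2 (sub_resource_lt hk (s := [a]) (by simp) (b :: w)
            (by simp) hwf))
    · have hs' := mem_partialSubpaths_of_append hne hs
      have hlen : s.length ≠ 0 := by simpa using hne
      refine ⟨fun h => absurd h (by simp; omega), fun _ => ?_⟩
      obtain ⟨u, hu⟩ : ∃ u, s.getLast? = some u := by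
        rw [← Option.isSome_iff_exists]; simpa using hne
      have harc : I.arc u v := (List.isChain_append.1 hs.1.chain).2.2 u hu v (by simp)
      -- The generated label that dominates `s` is not final: it is the seed itself, or it ends
      -- where `s` ends, which is a task because that node is interior to `s ++ [v]`. Its extensions
      -- have therefore been treated.
      obtain ⟨s', hs'g, hs'f, hs'd, hs'e⟩ : ∃ s' ∈ S.gen, s' ∈ I.partialSubpaths R ∧
          (A.sub d).Dominates s' s ∧ ¬ I.EndsSubpath s' := by
        by_cases h1 : s.length = 1
        · exact ⟨s, (ih hs').1 h1, hs', Criteria.Dominates.refl _ _, fun h => by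
            have := h.1; omega⟩
        · obtain ⟨s', hs'g, hs'l, hs'd⟩ := (ih hs').2 (by omega)
          have hs'f := mem_partialSubpaths_of_gen hS hs'g hs'l
          refine ⟨s', hs'g, hs'f, hs'd, ?_⟩
          rintro ⟨-, n, hn, hk⟩
          rw [(hE.sub s' hs'f s hs' hs'd.1).2] at hn
          refine hk (hs.1.interior n ?_)
          match s, hn with
          | [a], _ => simp at h1
          | a :: b :: s, hn =>
            simp only [List.cons_append, List.tail_cons]
            rw [← List.cons_append, List.dropLast_concat]
            exact List.mem_of_getLast? (by simpa using hn)
      have hu' : s'.getLast? = some u := by rw [(hE.sub s' hs'f s hs' hs'd.1).2, hu]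
      rcases h1 s' hs'f s hs' hs'd u v hu' hu harc with h | ⟨hf, -, hd⟩
      · exact absurd hs h
      · obtain ⟨w, hw, hwl, hwd⟩ := hS.closed s' hs'g hs'e _ ⟨u, v, hu', harc, rfl⟩ hf
        exact ⟨w, by simpa [hq] using hw, hwl, hwd.trans hd⟩

lemma gen_subset_subpaths {S : LabelState (List V)}
    (hS : (A.subProc I R d).Inv (subInit I).queue S) :
    {s ∈ S.gen | I.EndsSubpath s} ⊆ I.subpaths R := fun _ hs =>
  ⟨mem_partialSubpaths_of_gen hS hs.1 hs.2.1, hs.2⟩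

/-- At the end of the first level, every subpath is dominated by a generated one. -/
lemma exists_subpath_dominates [Fintype V] [DecidableEq V] (hE : A.RecordsEndpoints I R d)
    (h1 : A.SubpathDomination I R d) (h3 : A.SubpathTermination I R d) {S : LabelState (List V)}
    (hS : (A.subProc I R d).Inv (subInit I).queue S) (hq : S.queue = ∅) :
    ∀ s ∈ I.subpaths R, ∃ s' ∈ {s ∈ S.gen | I.EndsSubpath s}, (A.sub d).Dominates s' s := by
  intro s hs
  obtain ⟨s', hg, hl, hd⟩ := (exists_gen_dominates hE h1 h3 hS hq s hs.1).2 hs.2.1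
  refine ⟨s', ⟨hg, hl, ?_⟩, hd⟩
  rw [(hE.sub s' (mem_partialSubpaths_of_gen hS hg hl) s hs.1 hd.1).2]
  exact hs.2.2

/-- At the end of the second level, every feasible subpath sequence is dominated by a generated
one. -/
lemma exists_seq_gen_dominates (hE : A.RecordsEndpoints I R d) (h2 : A.SeqDomination I R d)
    {Sstar : Set (List V)} (hsub : Sstar ⊆ I.subpaths R)
    (hdom : ∀ s ∈ I.subpaths R, ∃ s' ∈ Sstar, (A.sub d).Dominates s' s)
    {S : LabelState (List (List V))}
    (hS : (A.seqProc I R d Sstar).Inv (seqInit I Sstar).queue S) (hq : S.queue = ∅)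
    (σ : List (List V)) (hσ : σ ∈ I.subpathSeqs R) :
    ∃ σ' ∈ S.gen, (A.seq d).Dominates σ' σ := by
  induction σ using List.reverseRecOn with
  | nil => exact absurd rfl hσ.1.ne_nil
  | append_singleton σ s ih =>
    have hs : s ∈ I.subpaths R := hσ.1.mem s (by simp)
    obtain ⟨s', hs', hd⟩ := hdom s hs
    have hs'f := hsub hs'
    have hhead := (hE.sub s' hs'f.1 s hs.1 hd.1).1
    by_cases hne : σ = []
    · subst hne
      rcases h2.left s' hs'f s hs hd [] (Or.inl rfl) with h | ⟨-, -, hd'⟩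
      · exact absurd hσ h
      · rw [List.nil_append] at hd' hσ ⊢
        have hstart := hσ.1.start
        rw [joinNodes_singleton, ← hhead] at hstart
        rcases hS.init_covered [s'] ⟨s', hs', hstart, rfl⟩ with h | ⟨w, hw, hwd⟩
        · exact ⟨[s'], by simpa [hq] using h, hd'⟩
        · exact ⟨w, by simpa [hq] using hw, Criteria.Dominates.trans hwd hd'⟩
    · have hσ' := mem_subpathSeqs_of_append hσ hne
      obtain ⟨τ, hτg, hτd⟩ := ih hσ'
      have hτf := seq_gen_subset hsub hS hτg
      obtain ⟨r, hr, hsr, hk⟩ := hσ.1.link_last hne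
      have hτr : (joinNodes τ).getLast? = some r := by
        rw [(hE.seq τ hτf σ hσ' hτd.1).2, hr]
      -- Since `τ` ends at the station where `s` begins, it has been extended.
      have hτc : ¬ I.IsComplete τ := by
        rintro ⟨n, hn, hkn⟩
        rw [hτr, Option.some.injEq] at hn
        subst hn
        simp [hk] at hkn
      rcases h2.right τ hτf σ hσ' hτd s hs (by rw [hτr, hsr]) (by rw [hr, hsr]) with
        h | ⟨hf, -, hd₁⟩
      · exact absurd hσ h
      rcases h2.left s' hs'f s hs hd τ (Or.inr ⟨hτf, by rw [hτr, hhead, hsr], by rw [hτr, hsr]⟩)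
        with h | ⟨hf', -, hd₂⟩
      · exact absurd hf h
      obtain ⟨w, hw, hwd⟩ := hS.closed τ hτg hτc _ ⟨s', hs', by rw [hτr, hhead, hsr], rfl⟩ hf'
      exact ⟨w, by simpa [hq] using hw,
        Criteria.Dominates.trans hwd (hd₂.trans hd₁)⟩

lemma isComplete_of_dominates (hE : A.RecordsEndpoints I R d) {σ σ' : List (List V)}
    (hσ : σ ∈ I.subpathSeqs R) (hσ' : σ' ∈ I.subpathSeqs R) (hd : (A.seq d).Dominates σ' σ)
    (hc : I.IsComplete σ) : I.IsComplete σ' := by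
  obtain ⟨n, hn, hk⟩ := hc
  exact ⟨n, by rw [(hE.seq σ' hσ' σ hσ hd.1).2, hn], hk⟩

end LabelData

section

open Instance LabelData

variable {V α ι β ι' : Type*} {A : LabelData V α ι β ι'} {I : Instance V} {R : SequenceRule V}
  {d : Duals V}

/-! ### Pricing -/

lemma mem_paths_of_isComplete {σ : List (List V)} (hσ : I.IsSubpathSeq R σ)
    (hc : I.IsComplete σ) {p : Path V} (hp : p ∈ I.partialPathsOf R σ) : p ∈ I.paths R := by
  refine ⟨hp.1, ?_, by rw [hp.2]; exact hc⟩
  obtain ⟨s, σ, rfl⟩ := List.exists_cons_of_ne_nil hσ.ne_nil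
  have h := congrArg List.length hp.2
  have hs := (hσ.mem s (by simp)).2.1
  rw [joinNodes_cons, List.length_append, nodes, List.length_map] at h
  omega

variable (I R) in
/-- The node sequences of partial paths for which `P` contains no cheapest one. -/
def uncovered (P : Set (Path V)) : Set (List V) :=
  {l ∈ nodes '' I.partialPaths R | ¬ ∃ q ∈ P, nodes q = l ∧
    ∀ p ∈ I.partialPaths R, nodes p = l → I.chargeCost q ≤ I.chargeCost p}

lemma finite_uncovered [Finite V] (P : Set (Path V)) : (uncovered I R P).Finite :=
  (I.finite_nodes_image R).subset fun _ h => h.1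

variable [Fintype V] [DecidableEq V]

lemma exists_isPricingOutcome (I : Instance V) (R : SequenceRule V) (d : Duals V)
    {gen : Set (List (List V))} (hgen : gen ⊆ I.subpathSeqs R) :
    ∃ Pnew, IsPricingOutcome I R d gen Pnew := by
  classical
  have h : ∀ σ, ∃ p, σ ∈ gen → I.IsMinimalPath R d σ p := fun σ => by
    by_cases hσ : σ ∈ gen
    · obtain ⟨p, hp⟩ := exists_isMinimalPath (hgen hσ) d
      exact ⟨p, fun _ => hp⟩
    · exact ⟨[], fun h => absurd h hσ⟩
  choose f hf using h
  exact ⟨_, f, fun σ hσ _ => hf σ hσ, rfl⟩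

lemma IsPricingOutcome.finite {gen : Set (List (List V))} (hgen : gen ⊆ I.subpathSeqs R)
    {Pnew : Set (Path V)} (h : IsPricingOutcome I R d gen Pnew) : Pnew.Finite := by
  obtain ⟨f, -, rfl⟩ := h
  refine (((I.finite_subpathSeqs R).subset hgen).image f).subset ?_
  rintro p ⟨⟨σ, hσ, -, rfl⟩, -⟩
  exact ⟨σ, hσ, rfl⟩

lemma IsPricingOutcome.subset_paths {gen : Set (List (List V))} (hgen : gen ⊆ I.subpathSeqs R)
    {Pnew : Set (Path V)} (h : IsPricingOutcome I R d gen Pnew) : Pnew ⊆ I.paths R := by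
  obtain ⟨f, hf, rfl⟩ := h
  rintro p ⟨⟨σ, hσ, hc, rfl⟩, -⟩
  exact mem_paths_of_isComplete (hgen hσ).1 hc (hf σ hσ hc).1

/-- If every subpath sequence is dominated by a generated one and no minimal path of a generated
complete sequence has a negative reduced cost, then no path has. -/
lemma IsPricingOutcome.reducedCost_nonneg (hE : A.RecordsEndpoints I R d)
    (h4 : A.SeqTermination I R d) {gen : Set (List (List V))} (hgen : gen ⊆ I.subpathSeqs R)
    (hdom : ∀ σ ∈ I.subpathSeqs R, ∃ σ' ∈ gen, (A.seq d).Dominates σ' σ)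
    (h : IsPricingOutcome I R d gen ∅) {p : Path V} (hp : p ∈ I.paths R) :
    0 ≤ I.reducedCost d p := by
  obtain ⟨σ, hσ, hc, hpσ⟩ := exists_subpathSeq hp
  obtain ⟨σ', hσ', hd⟩ := hdom σ hσ
  have hc' := isComplete_of_dominates hE hσ (hgen hσ') hd hc
  obtain ⟨f, hf, hempty⟩ := h
  have hmin := hf σ' hσ' hc'
  obtain ⟨q, hq⟩ := exists_isMinimalPath hσ d
  have h0 : 0 ≤ I.reducedCost d (f σ') := by
    by_contra hneg
    have : f σ' ∈ (∅ : Set (Path V)) := by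
      rw [hempty]
      exact ⟨⟨σ', hσ', hc', rfl⟩, not_le.1 hneg⟩
    exact this
  rw [← pathRC_eq_reducedCost d (hgen hσ').1 hmin.1] at h0
  rw [← pathRC_eq_reducedCost d hσ.1 hpσ]
  -- The minimal path of the dominating generated sequence costs no more than the minimal path of
  -- `σ`, which costs no more than `p`.
  exact h0.trans ((h4.mono σ' (hgen hσ') σ hσ hd _ _ hmin hq).trans (hq.2 p hpσ))

/-- For fixed nodes, reduced costs differ only by charging costs. A cheapest path in `P` with the
nodes of a new path would have a reduced cost no larger than that of the new path, hence negative,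
against dual feasibility. The new path is itself cheapest for its nodes, so these become covered. -/
lemma IsPricingOutcome.ncard_uncovered_lt {gen : Set (List (List V))} {P Pnew : Set (Path V)}
    (hd : I.IsDualFeasible P d)
    (h : IsPricingOutcome I R d gen Pnew) (hne : Pnew ≠ ∅) :
    (uncovered I R (P ∪ Pnew)).ncard < (uncovered I R P).ncard := by
  obtain ⟨f, hf, rfl⟩ := h
  obtain ⟨p, hp⟩ := Set.nonempty_iff_ne_empty.2 hne
  refine Set.ncard_lt_ncard ⟨?_, fun hsub => ?_⟩ (finite_uncovered _)
  · rintro l ⟨hl, hl'⟩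
    exact ⟨hl, fun ⟨q, hq, h⟩ => hl' ⟨q, Or.inl hq, h⟩⟩
  have hp' := hp
  obtain ⟨⟨σ, hσ, hc, rfl⟩, hneg⟩ := hp'
  have hmin := hf σ hσ hc
  have hmem : nodes (f σ) ∈ uncovered I R P := by
    refine ⟨⟨_, hmin.1.1, rfl⟩, ?_⟩
    rintro ⟨q, hq, hqn, hqmin⟩
    have h1 := hqmin _ hmin.1.1 rfl
    have h2 := hd.2 q hq
    simp only [reducedCost, pathCost, hqn] at h2 hneg
    linarith
  refine (hsub hmem).2 ⟨f σ, Or.inr hp, rfl, fun q hq hqn => ?_⟩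
  have := hmin.2 q ⟨hq, hqn.trans hmin.1.2⟩
  simpa [pathRC] using this

/-! ### Invariants of column generation -/

variable (I R) in
/-- What holds for the current path set. -/
structure IsMaster (P : Set (Path V)) : Prop where
  finite : P.Finite
  subset : P ⊆ I.paths R
  feasible : ∃ z, I.IsFeasible P z

variable (I R) in
/-- What holds for the current path set, master solution and dual solution during pricing. -/
structure IsSolved (P : Set (Path V)) (z : Path V →₀ ℝ) (d : Duals V) : Prop where
  master : IsMaster I R P
  primal : I.IsOptimal P z
  dual : I.IsDualOptimal P d

variable (I R A) in
/-- The invariants of column generation. -/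
def CGState.Valid : CGState V → Prop
  | .master P => IsMaster I R P
  | .firstLevel P z d S => IsSolved I R P z d ∧ (A.subProc I R d).Inv (subInit I).queue S
  | .secondLevel P z d Sstar S => IsSolved I R P z d ∧ Sstar ⊆ I.subpaths R ∧
      (∀ s ∈ I.subpaths R, ∃ s' ∈ Sstar, (A.sub d).Dominates s' s) ∧
      (A.seqProc I R d Sstar).Inv (seqInit I Sstar).queue S
  | .stopped z => I.IsOptimal (I.paths R) z

variable (I R) in
/-- The progress measure of column generation, decreasing lexicographically. -/
noncomputable def CGState.measure : CGState V → ℕ × ℕ × ℕ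
  | .master P => ((uncovered I R P).ncard, 3, 0)
  | .firstLevel P _ _ S => ((uncovered I R P).ncard, 2,
      (((subInit I).queue ∪ I.partialSubpaths R) \ S.gen).ncard)
  | .secondLevel P _ _ _ S => ((uncovered I R P).ncard, 1, (I.subpathSeqs R \ S.gen).ncard)
  | .stopped _ => (0, 0, 0)

/-- The lexicographic order on triples of natural numbers. -/
def lexTriple : ℕ × ℕ × ℕ → ℕ × ℕ × ℕ → Prop := Prod.Lex (· < ·) (Prod.Lex (· < ·) (· < ·))

lemma wellFounded_lexTriple : WellFounded lexTriple :=
  WellFounded.prod_lex Nat.lt_wfRel.wf (WellFounded.prod_lex Nat.lt_wfRel.wf Nat.lt_wfRel.wf)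

lemma CGState.Valid.step (hE : ∀ d, A.RecordsEndpoints I R d)
    (h1 : ∀ d, A.SubpathDomination I R d) (h2 : ∀ d, A.SeqDomination I R d)
    (h3 : ∀ d, A.SubpathTermination I R d) (h4 : ∀ d, A.SeqTermination I R d)
    {S S' : CGState V} (hS : S.Valid A I R) (h : CGStep I R A S S') : S'.Valid A I R := by
  cases h with
  | solve P z d hz hd => exact ⟨⟨hS, hz, hd⟩, LabelProc.Inv.start _⟩
  | first P z d S S' h =>
    exact ⟨hS.1, hS.2.step subProc_prunes_trans subProc_prunes_self h⟩
  | toSecond P z d S h =>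
    exact ⟨hS.1, gen_subset_subpaths hS.2,
      exists_subpath_dominates (hE d) (h1 d) (h3 d) hS.2 h, LabelProc.Inv.start _⟩
  | second P z d Sstar S S' h =>
    exact ⟨hS.1, hS.2.1, hS.2.2.1, hS.2.2.2.step seqProc_prunes_trans
      (fun _ y _ => Criteria.Dominates.refl _ y) h⟩
  | addPaths P z d Sstar S h Pnew hP hne =>
    have hgen := seq_gen_subset hS.2.1 hS.2.2.2
    obtain ⟨z, hz⟩ := hS.1.master.feasible
    exact ⟨hS.1.master.finite.union (hP.finite hgen),
      Set.union_subset hS.1.master.subset (hP.subset_paths hgen),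
      z, { hz with support := fun p hp => Or.inl (hz.support p hp) }⟩
  | finish P z d Sstar S h hP =>
    have hgen := seq_gen_subset hS.2.1 hS.2.2.2
    exact isOptimal_of_reducedCost_nonneg hS.1.master.finite hS.1.master.subset
      hS.1.master.subset hS.1.primal hS.1.dual fun p hp =>
        hP.reducedCost_nonneg (hE d) (h4 d) hgen
          (exists_seq_gen_dominates (hE d) (h2 d) hS.2.1 hS.2.2.1 hS.2.2.2 h) hp

/-- Within a level the count of labels not yet generated falls; between levels the phase number
falls; a return to the master problem raises the phase but covers a further node sequence. -/
lemma CGStep.measure_lt {S S' : CGState V} (hS : S.Valid A I R) (h : CGStep I R A S S') :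
    lexTriple (S'.measure I R) (S.measure I R) := by
  cases h with
  | solve P z d hz hd => exact Prod.Lex.right _ (Prod.Lex.left _ _ (by norm_num))
  | first P z d S S' h =>
    exact Prod.Lex.right _ (Prod.Lex.right _ (h.ncard_lt
      ((subInit_finite I).union (I.finite_partialSubpaths R)) subset_rfl hS.2))
  | toSecond P z d S h => exact Prod.Lex.right _ (Prod.Lex.left _ _ (by norm_num))
  | second P z d Sstar S S' h =>
    exact Prod.Lex.right _ (Prod.Lex.right _ (h.ncard_lt (I.finite_subpathSeqs R)
      (Set.union_subset (seqInit_subset hS.2.1) subset_rfl) hS.2.2.2))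
  | addPaths P z d Sstar S h Pnew hP hne =>
    exact Prod.Lex.left _ _ (hP.ncard_uncovered_lt hS.1.dual.1 hne)
  | finish P z d Sstar S h hP =>
    simp only [CGState.measure]
    -- The stopped state has first component `0`; if this is no decrease, the phase number provides
    -- one.
    rcases Nat.eq_zero_or_pos (uncovered I R P).ncard with h0 | h0
    · rw [h0]
      exact Prod.Lex.right _ (Prod.Lex.left _ _ (by norm_num))
    · exact Prod.Lex.left _ _ h0

lemma CGState.Valid.exists_step {S : CGState V} (hS : S.Valid A I R) (hrun : ¬ S.IsStopped) :
    ∃ S', CGStep I R A S S' := by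
  cases S with
  | master P =>
    obtain ⟨z, hz⟩ := exists_isOptimal hS.finite hS.subset hS.feasible
    obtain ⟨d, hd⟩ := exists_isDualOptimal hS.finite hS.subset hz
    exact ⟨_, .solve P z d hz hd⟩
  | firstLevel P z d S =>
    by_cases hq : S.queue = ∅
    · exact ⟨_, .toSecond P z d S hq⟩
    · have hfin : S.queue.Finite :=
        ((subInit_finite I).union (I.finite_partialSubpaths R)).subset hS.2.queue_subset
      obtain ⟨S', h⟩ := LabelProc.exists_step hfin (Set.nonempty_iff_ne_empty.2 hq)
        (subProc_extensions_finite (A := A) (I := I) (R := R) (d := d))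
      exact ⟨_, .first P z d S S' h⟩
  | secondLevel P z d Sstar S =>
    obtain ⟨hsol, hsub, hdom, hinv⟩ := hS
    by_cases hq : S.queue = ∅
    · obtain ⟨Pnew, hP⟩ := exists_isPricingOutcome I R d (seq_gen_subset hsub hinv)
      by_cases hne : Pnew = ∅
      · subst hne
        exact ⟨_, .finish P z d Sstar S hq hP⟩
      · exact ⟨_, .addPaths P z d Sstar S hq Pnew hP hne⟩
    · have hfin : S.queue.Finite := (I.finite_subpathSeqs R).subset
        (hinv.queue_subset.trans (Set.union_subset (seqInit_subset hsub) subset_rfl))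
      obtain ⟨S', h⟩ := LabelProc.exists_step hfin (Set.nonempty_iff_ne_empty.2 hq)
        (seqProc_extensions_finite (A := A) (I := I) (R := R) (d := d)
          ((I.finite_subpaths R).subset hsub))
      exact ⟨_, .second P z d Sstar S S' h⟩
  | stopped z => exact absurd ⟨z, rfl⟩ hrun

end

end ERSP

/-! ### Termination and optimality of column generation -/

theorem theorem2 {V α ι β ι' : Type*} [Fintype V] [DecidableEq V]
    (I : ERSP.Instance V) (R : ERSP.SequenceRule V) (A : ERSP.LabelData V α ι β ι')
    (hEnds : ∀ d, A.RecordsEndpoints I R d)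
    (h1 : ∀ d, A.SubpathDomination I R d)
    (h2 : ∀ d, A.SeqDomination I R d)
    (h3 : ∀ d, A.SubpathTermination I R d)
    (h4 : ∀ d, A.SeqTermination I R d)
    (P₀ : Set (ERSP.Path V)) (hsub : P₀ ⊆ I.paths R) (hfin : P₀.Finite)
    (hfeas : ∃ z, I.IsFeasible P₀ z) :
    ERSP.Terminates (ERSP.CGStep I R A) ERSP.CGState.IsStopped (ERSP.CGState.master P₀) ∧
      ∀ z, Relation.ReflTransGen (ERSP.CGStep I R A) (ERSP.CGState.master P₀)
          (ERSP.CGState.stopped z) →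
        I.IsOptimal (I.paths R) z := by
  -- Validity of reachable states carries everything: it excludes deadlock, makes the measure
  -- decrease, and for a stopped state it is optimality over all paths.
  have hvalid : ∀ S, Relation.ReflTransGen (ERSP.CGStep I R A) (ERSP.CGState.master P₀) S →
      S.Valid A I R := by
    intro S h
    induction h with
    | refl => exact ⟨hfin, hsub, hfeas⟩
    | tail _ h ih => exact ih.step hEnds h1 h2 h3 h4 h
  refine ⟨⟨?_, fun S hS hrun => (hvalid S hS).exists_step hrun⟩, fun z hz => hvalid _ hz⟩
  rintro ⟨f, hf0, hf⟩
  have hreach : ∀ n, Relation.ReflTransGen (ERSP.CGStep I R A) (ERSP.CGState.master P₀) (f n) := by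
    intro n
    induction n with
    | zero => rw [hf0]
    | succ n ih => exact ih.tail (hf n)
  exact (wellFounded_iff_isEmpty_descending_chain.1 ERSP.wellFounded_lexTriple).elim
    ⟨fun n => (f n).measure I R, fun n => (hf n).measure_lt (hvalid _ (hreach n))⟩
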